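/- For a bounded linear operator $S:H\to G$ between real Hilbert spaces let $e(0,S)=\sup_{\|f\|_H\le 1}\|Sf\|_G$ and, for $n\ge 1$, let $e(n,S)=\inf_A\sup_{\|f\|_H\le1}\|Sf-A(f)\|_G$, where the infimum is over all algorithms $A(f)=\varphi(L_1(f),\dots,L_n(f))$ with continuous linear functionals $L_i$ on $H$ and measurable $\varphi:\mathbb R^n\to G$. The information complexity for the normalized error criterion is $n(\varepsilon,S)=\min\{n\ge 0: e(n,S)\le\varepsilon\, e(0,S)\}$. A sequence $\{S_d\}_{d\ge1}$ of such operators is called * strongly polynomially tractable (SPT) if there are $C,p\ge0$ with $n(\varepsilon,S_d)\le C\varepsilon^{-p}$ for all $d\ge1$, $\varepsilon\in(0,1)$; the exponent of SPT is the infimum of such $p$; * polynomially tractable (PT) if there are $C,p,q\ge0$ with $n(\varepsilon,S_d)\le Cd^q\varepsilon^{-p}$ for all $d\ge1$, $\varepsilon\in(0,1)$; * quasi-polynomially tractable (QPT) if there are $C,t>0$ with $n(\varepsilon,S_d)\le C\exp\big(t(1+\ln d)(1+\ln\varepsilon^{-1})\big)$ for all $d\ge1$, $\varepsilon\in(0,1)$;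 the exponent of QPT is the infimum of such $t$; * $(s,t)$-weakly tractable, for $s,t>0$, if $\ln n(\varepsilon,S_d)/(\varepsilon^{-s}+d^{t})\to0$ as $\varepsilon^{-1}+d\to\infty$ (with $\varepsilon\in(0,1)$, $d\ge1$); weakly tractable if it is $(1,1)$-weakly tractable; uniformly weakly tractable if it is $(s,t)$-weakly tractable for all $s,t>0$. Let $\gamma_1^2\ge\gamma_2^2\ge\dots>0$. For $d\ge1$ let $H(K_{d,\gamma})$ be the reproducing kernel Hilbert space of real functions on $\mathbb R^d$ with the Gaussian kernel $K_{d,\gamma}(x,y)=\prod_{j=1}^d\exp(-\gamma_j^2(x_j-y_j)^2)$, let $L_{2,d}$ be the space $L_2$ on $\mathbb R^d$ with respect to the weight $\prod_{j=1}^d\pi^{-1/2}\exp(-x_j^2)$, and let $\mathrm{APP}_d:H(K_{d,\gamma})\to L_{2,d}$, $\mathrm{APP}_df=f$, be the embedding. Put $$\omega_\gamma=\frac{2\gamma^2}{1+2\gamma^2+\sqrt{1+4\gamma^2}},\qquad r(\gamma)=\liminf_{k\to\infty}\frac{\ln\gamma_k^{-2}}{\ln k}\in[0,\infty].$$ Then,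 for the normalized error criterion and the problem $\mathrm{APP}=\{\mathrm{APP}_d\}_{d\ge1}$ (with the convention $2/\infty=0$): 1. $r(\gamma)=\liminf_{k\to\infty}\frac{\ln\omega_{\gamma_k}^{-1}}{\ln k}$; $\mathrm{APP}$ is SPT if and only if $r(\gamma)>0$, and in that case the exponent of SPT is $2/r(\gamma)$. 2. $\mathrm{APP}$ is SPT if and only if it is PT. 3. $\mathrm{APP}$ is QPT for all shape parameters, and the exponent of QPT is $$t^*=\frac{2}{\lim_{k\to\infty}\ln\frac{1+2\gamma_k^2+\sqrt{1+4\gamma_k^2}}{2\gamma_k^2}},$$ where the limit exists in $(0,\infty]$. 4. $\mathrm{APP}$ is $(s,t)$-weakly tractable for all $s,t>0$, uniformly weakly tractable and weakly tractable, for all shape parameters. -/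

import Mathlib

open Filter Topology MeasureTheory
open scoped ENNReal

/-! ## Worst case approximation of linear operators -/

section InformationBasedComplexity

variable {H G : Type*} [NormedAddCommGroup H] [NormedSpace ℝ H]
  [NormedAddCommGroup G] [NormedSpace ℝ G]

/-- The worst case error `sup_{‖f‖ ≤ 1} ‖S f - A f‖` of an algorithm `A` for the operator `S`. -/
noncomputable def worstCaseError (S : H →L[ℝ] G) (A : H → G) : ℝ≥0∞ :=
  ⨆ (f : H) (_ : ‖f‖ ≤ 1), ‖S f - A f‖ₑ

/-- The `n`th minimal worst case error `e(n, S)`. For `n ≥ 1` it is the infimum of the worst case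
errors of all algorithms `f ↦ φ (L₁ f, …, Lₙ f)` with continuous linear functionals `Lᵢ` and a
Borel measurable `φ : ℝⁿ → G`; for `n = 0` it is the initial error, the error of `A = 0`. -/
noncomputable def minimalError (S : H →L[ℝ] G) : ℕ → ℝ≥0∞
  | 0 => worstCaseError S 0
  | n + 1 => ⨅ (L : Fin (n + 1) → (H →L[ℝ] ℝ)) (φ : (Fin (n + 1) → ℝ) → G)
      (_ : @Measurable _ _ _ (borel G) φ), worstCaseError S (fun f => φ (fun i => L i f))

/-- The information complexity of `S` for the normalized error criterion: the least `n` with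
`e(n, S) ≤ ε e(0, S)` (and `∞` if there is no such `n`). -/
noncomputable def infoComplexityNOR (S : H →L[ℝ] G) (ε : ℝ) : ℕ∞ :=
  ⨅ (n : ℕ) (_ : minimalError S n ≤ ENNReal.ofReal ε * minimalError S 0), (n : ℕ∞)

end InformationBasedComplexity

/-! ## Tractability notions

Here `n ε d` is the information complexity of the `d`-variate problem, for `ε ∈ (0,1)` and `d ≥ 1`.
-/

/-- `n(ε,d) ≤ C ε⁻ᵖ` for some `C ≥ 0`, where `p ≥ 0`. -/
def SPTBound (n : ℝ → ℕ → ℕ∞) (p : ℝ) : Prop :=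
  0 ≤ p ∧ ∃ C : ℝ, 0 ≤ C ∧ ∀ d : ℕ, 1 ≤ d → ∀ ε : ℝ, 0 < ε → ε < 1 →
    (n ε d : ℝ≥0∞) ≤ ENNReal.ofReal (C * ε⁻¹ ^ p)

/-- Strong polynomial tractability. -/
def IsSPT (n : ℝ → ℕ → ℕ∞) : Prop := ∃ p : ℝ, SPTBound n p

/-- The exponent of strong polynomial tractability. -/
noncomputable def sptExponent (n : ℝ → ℕ → ℕ∞) : EReal :=
  ⨅ (p : ℝ) (_ : SPTBound n p), (p : EReal)

/-- Polynomial tractability. -/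
def IsPT (n : ℝ → ℕ → ℕ∞) : Prop :=
  ∃ C p q : ℝ, 0 ≤ C ∧ 0 ≤ p ∧ 0 ≤ q ∧ ∀ d : ℕ, 1 ≤ d → ∀ ε : ℝ, 0 < ε → ε < 1 →
    (n ε d : ℝ≥0∞) ≤ ENNReal.ofReal (C * (d : ℝ) ^ q * ε⁻¹ ^ p)

/-- `n(ε,d) ≤ C exp(t (1 + ln d) (1 + ln ε⁻¹))` for some `C > 0`, where `t > 0`. -/
def QPTBound (n : ℝ → ℕ → ℕ∞) (t : ℝ) : Prop :=
  0 < t ∧ ∃ C : ℝ, 0 < C ∧ ∀ d : ℕ, 1 ≤ d → ∀ ε : ℝ, 0 < ε → ε < 1 →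
    (n ε d : ℝ≥0∞) ≤
      ENNReal.ofReal (C * Real.exp (t * (1 + Real.log d) * (1 + Real.log ε⁻¹)))

/-- Quasi-polynomial tractability. -/
def IsQPT (n : ℝ → ℕ → ℕ∞) : Prop := ∃ t : ℝ, QPTBound n t

/-- The exponent of quasi-polynomial tractability. -/
noncomputable def qptExponent (n : ℝ → ℕ → ℕ∞) : EReal :=
  ⨅ (t : ℝ) (_ : QPTBound n t), (t : EReal)

/-- `ln n(ε,d) / (ε⁻ˢ + dᵗ) → 0` as `ε⁻¹ + d → ∞`, over `ε ∈ (0,1)` and `d ≥ 1`. -/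
def IsSTWT (n : ℝ → ℕ → ℕ∞) (s t : ℝ) : Prop :=
  Tendsto (fun x : ℝ × ℕ =>
      ENNReal.log (n x.1 x.2 : ℝ≥0∞) / ((x.1⁻¹ ^ s + (x.2 : ℝ) ^ t : ℝ) : EReal))
    (comap (fun x : ℝ × ℕ => x.1⁻¹ + (x.2 : ℝ)) atTop ⊓
      𝓟 {x : ℝ × ℕ | 0 < x.1 ∧ x.1 < 1 ∧ 1 ≤ x.2}) (𝓝 0)

/-- Weak tractability. -/
def IsWT (n : ℝ → ℕ → ℕ∞) : Prop := IsSTWT n 1 1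

/-- Uniform weak tractability. -/
def IsUWT (n : ℝ → ℕ → ℕ∞) : Prop := ∀ α β : ℝ, 0 < α → 0 < β → IsSTWT n α β

/-! ## The Gaussian reproducing kernel Hilbert space -/

/-- The product Gaussian kernel `∏_{j=1}^d exp(-γ_j² (x_j - y_j)²)` on `ℝᵈ`, as a matrix whose
entries are multiplication operators on `ℝ`. The sequence of parameters starts at `γ 1`. -/
noncomputable def gaussianKernel (γ : ℕ → ℝ) (d : ℕ) :
    Matrix (Fin d → ℝ) (Fin d → ℝ) (ℝ →L[ℝ] ℝ) :=
  Matrix.of fun x y =>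
    (∏ j : Fin d, Real.exp (-(γ (j + 1) ^ 2 * (x j - y j) ^ 2))) • ContinuousLinearMap.id ℝ ℝ

theorem posSemidef_gaussian_one (c : ℝ) :
    (Matrix.of fun x y : ℝ => Real.exp (-(c ^ 2 * (x - y) ^ 2))).PosSemidef := by
  obtain ⟨v, hv⟩ : ∃ v : NNReal, (v : ℝ) = 2 * c ^ 2 :=
    ⟨(2 * c ^ 2).toNNReal, Real.coe_toNNReal _ (by positivity)⟩
  have key : ∀ u : ℝ, Real.exp (-(c ^ 2 * u ^ 2)) =
      ∫ s, Real.cos (s * u) ∂(ProbabilityTheory.gaussianReal 0 v) := by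
    intro u
    have h := ProbabilityTheory.charFun_gaussianReal (μ := 0) (v := v) u
    have h2 := congrArg Complex.re h
    rw [charFun_apply_real] at h2
    have h3 : ∀ f : ℝ → ℂ, Integrable f
        (ProbabilityTheory.gaussianReal 0 v) →
        (∫ s, f s ∂(ProbabilityTheory.gaussianReal 0 v)).re =
        ∫ s, (f s).re ∂(ProbabilityTheory.gaussianReal 0 v) :=
      fun f hf => (integral_re hf).symm
    rw [h3] at h2
    · have e1 : ∀ s : ℝ, (Complex.exp (u * s * Complex.I)).re = Real.cos (s * u) := by
        intro s
        rw [← Complex.ofReal_mul, Complex.exp_ofReal_mul_I_re, mul_comm]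
      simp only [e1] at h2
      rw [h2]
      have e2 : (u * (0 : ℝ) * Complex.I - (((v : ℝ) : ℂ)) * u ^ 2 / 2)
          = ((-(c ^ 2 * u ^ 2) : ℝ) : ℂ) := by
        rw [hv]
        push_cast
        ring
      rw [e2, ← Complex.ofReal_exp, Complex.ofReal_re]
    · refine Integrable.of_bound (C := 1) (by fun_prop) (ae_of_all _ fun s => ?_)
      rw [← Complex.ofReal_mul, Complex.norm_exp_ofReal_mul_I]
  refine ⟨?_, fun x => ?_⟩
  · ext i j
    simp only [Matrix.conjTranspose_apply, Matrix.of_apply, star_trivial]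
    congr 2
    ring
  · simp only [Finsupp.sum, Matrix.of_apply, star_trivial, key]
    have hint : ∀ i j : ℝ, Integrable (fun s : ℝ => x i * Real.cos (s * (i - j)) * x j)
        (ProbabilityTheory.gaussianReal 0 v) := by
      intro i j
      refine Integrable.mul_const (Integrable.const_mul ?_ _) _
      refine Integrable.of_bound (C := 1) (by fun_prop) (ae_of_all _ fun s => ?_)
      exact Real.abs_cos_le_one _
    have e : ∑ i ∈ x.support, ∑ j ∈ x.support, x i * (∫ s, Real.cos (s * (i - j))
          ∂(ProbabilityTheory.gaussianReal 0 v)) * x j =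
        ∫ s, ∑ i ∈ x.support, ∑ j ∈ x.support, x i * Real.cos (s * (i - j)) * x j
          ∂(ProbabilityTheory.gaussianReal 0 v) := by
      rw [integral_finsetSum _ fun i _ => integrable_finsetSum _ fun j _ => hint i j]
      refine Finset.sum_congr rfl fun i _ => ?_
      rw [integral_finsetSum _ fun j _ => hint i j]
      refine Finset.sum_congr rfl fun j _ => ?_
      rw [integral_mul_const, integral_const_mul]
    rw [e]
    refine integral_nonneg fun s => ?_
    have e' : ∑ i ∈ x.support, ∑ j ∈ x.support, x i * Real.cos (s * (i - j)) * x j =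
        (∑ i ∈ x.support, x i * Real.cos (s * i)) ^ 2 +
          (∑ i ∈ x.support, x i * Real.sin (s * i)) ^ 2 := by
      rw [sq, sq, Finset.sum_mul_sum, Finset.sum_mul_sum, ← Finset.sum_add_distrib]
      refine Finset.sum_congr rfl fun i _ => ?_
      rw [← Finset.sum_add_distrib]
      refine Finset.sum_congr rfl fun j _ => ?_
      rw [mul_sub, Real.cos_sub]
      ring
    simp only [e', Pi.zero_apply]
    positivity

theorem posSemidef_gaussian_prod {ι : Type*} (s : Finset ι) (c : ι → ℝ) :
    (Matrix.of fun x y : ι → ℝ =>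
      ∏ j ∈ s, Real.exp (-(c j ^ 2 * (x j - y j) ^ 2))).PosSemidef := by
  classical
  induction s using Finset.induction_on with
  | empty =>
    have h := (posSemidef_gaussian_one 0).submatrix (fun _ : ι → ℝ => (0 : ℝ))
    convert h using 1
    ext x y
    simp
  | insert a s ha ih =>
    have h := ((posSemidef_gaussian_one (c a)).submatrix (fun x : ι → ℝ => x a)).hadamard ih
    have e : (Matrix.of fun x y : ι → ℝ =>
        ∏ j ∈ insert a s, Real.exp (-(c j ^ 2 * (x j - y j) ^ 2))) =
        ((Matrix.of fun x y : ℝ => Real.exp (-(c a ^ 2 * (x - y) ^ 2))).submatrix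
          (fun x : ι → ℝ => x a) (fun x : ι → ℝ => x a)).hadamard
        (Matrix.of fun x y : ι → ℝ => ∏ j ∈ s, Real.exp (-(c j ^ 2 * (x j - y j) ^ 2))) := by
      ext x y
      simp [Finset.prod_insert ha]
    rw [e]
    exact h

instance instFactPosSemidefGaussianKernel (γ : ℕ → ℝ) (d : ℕ) :
    Fact (gaussianKernel γ d).PosSemidef := by
  have h := posSemidef_gaussian_prod (Finset.univ : Finset (Fin d)) (fun j => γ (j + 1))
  have t := (RKHS.posSemidef_tfae (K := gaussianKernel γ d)).out 0 2
  refine ⟨t.mpr ⟨?_, fun v => ?_⟩⟩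
  · ext x y
    have := h.1.apply x y
    simp only [star_trivial, Matrix.of_apply] at this
    have hid : star (ContinuousLinearMap.id ℝ ℝ) = ContinuousLinearMap.id ℝ ℝ :=
      star_one (ℝ →L[ℝ] ℝ)
    simp [gaussianKernel, this, hid]
  · have := h.2 v
    simp only [star_trivial, Matrix.of_apply] at this
    rw [Finsupp.sum_comm] at this
    simpa [gaussianKernel, Finsupp.sum, mul_comm, mul_left_comm] using this

/-- `H(K_{d,γ})`: the reproducing kernel Hilbert space of functions on `ℝᵈ` with kernel
`gaussianKernel γ d`. -/
abbrev GaussianRKHS (γ : ℕ → ℝ) (d : ℕ) := RKHS.OfKernel (gaussianKernel γ d)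

/-- The measure `∏ⱼ exp(-xⱼ²)/√π dx` on `ℝᵈ`. -/
noncomputable def gaussianWeight (d : ℕ) : Measure (Fin d → ℝ) :=
  volume.withDensity fun x => ENNReal.ofReal (∏ j : Fin d, (Real.exp (-(x j) ^ 2) / √Real.pi))

instance instIsFiniteMeasureGaussianWeight (d : ℕ) : IsFiniteMeasure (gaussianWeight d) := by
  refine isFiniteMeasure_withDensity_ofReal ?_
  refine Integrable.hasFiniteIntegral ?_
  have h : Integrable (fun x : ℝ => Real.exp (-x ^ 2) / √Real.pi) := by
    have := integrable_exp_neg_mul_sq (b := 1) one_pos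
    simp only [neg_mul, one_mul] at this
    exact this.div_const _
  exact Integrable.fintype_prod (f := fun _ x => Real.exp (-x ^ 2) / √Real.pi) fun _ => h

theorem gaussianRKHS_norm_apply_le {γ : ℕ → ℝ} {d : ℕ} (f : GaussianRKHS γ d) (x : Fin d → ℝ) :
    ‖f x‖ ≤ ‖f‖ := by
  have h := RKHS.norm_apply_le f x
  rw [RKHS.OfKernel.kernel_ofKernel] at h
  simpa [gaussianKernel] using h

theorem gaussianRKHS_continuous {γ : ℕ → ℝ} {d : ℕ} (f : GaussianRKHS γ d) :
    Continuous (fun x => f x) := by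
  have hk : Continuous fun x : Fin d → ℝ => RKHS.kerFun (GaussianRKHS γ d) x 1 := by
    have hn : ∀ x y : Fin d → ℝ,
        ‖RKHS.kerFun (GaussianRKHS γ d) x 1 - RKHS.kerFun (GaussianRKHS γ d) y 1‖ ^ 2 =
        2 - 2 * ∏ j : Fin d, Real.exp (-(γ (j + 1) ^ 2 * (x j - y j) ^ 2)) := by
      intro x y
      rw [norm_sub_sq_real, ← real_inner_self_eq_norm_sq, ← real_inner_self_eq_norm_sq,
        ← RKHS.kernel_inner, ← RKHS.kernel_inner, ← RKHS.kernel_inner,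
        RKHS.OfKernel.kernel_ofKernel]
      have : ∀ j : Fin d, (y j - x j) ^ 2 = (x j - y j) ^ 2 := fun j => by ring
      simp [gaussianKernel, this]
      ring
    rw [continuous_iff_continuousAt]
    intro y
    rw [ContinuousAt, tendsto_iff_norm_sub_tendsto_zero]
    have h2 : Tendsto (fun x : Fin d → ℝ =>
        ‖RKHS.kerFun (GaussianRKHS γ d) x 1 - RKHS.kerFun (GaussianRKHS γ d) y 1‖ ^ 2)
        (𝓝 y) (𝓝 0) := by
      simp only [hn]
      have hc : Continuous fun x : Fin d → ℝ =>
          2 - 2 * ∏ j : Fin d, Real.exp (-(γ (j + 1) ^ 2 * (x j - y j) ^ 2)) := by fun_prop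
      have := hc.tendsto y
      simpa using this
    have h3 := h2.sqrt
    simpa [Real.sqrt_sq (norm_nonneg _)] using h3
  have e : (fun x => f x) = fun x => inner ℝ (RKHS.kerFun (GaussianRKHS γ d) x 1) f := by
    ext x
    simp
  rw [e]
  exact hk.inner continuous_const

/-- The elements of the Gaussian RKHS, as bounded continuous functions. -/
noncomputable def gaussianToBCF (γ : ℕ → ℝ) (d : ℕ) :
    GaussianRKHS γ d →L[ℝ] BoundedContinuousFunction (Fin d → ℝ) ℝ :=
  LinearMap.mkContinuous
    { toFun := fun f => BoundedContinuousFunction.ofNormedAddCommGroup (fun x => f x)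
        (gaussianRKHS_continuous f) ‖f‖ (gaussianRKHS_norm_apply_le f)
      map_add' := fun f g => by ext x; simp
      map_smul' := fun c f => by ext x; simp }
    1 fun f => by
      rw [one_mul]
      exact BoundedContinuousFunction.norm_ofNormedAddCommGroup_le _ (norm_nonneg _)
        (gaussianRKHS_norm_apply_le f)

/-- The embedding `APP_d : H(K_{d,γ}) → L_{2,d}`, `APP_d f = f`. -/
noncomputable def gaussianAPP (γ : ℕ → ℝ) (d : ℕ) :
    GaussianRKHS γ d →L[ℝ] Lp ℝ 2 (gaussianWeight d) :=
  (BoundedContinuousFunction.toLp 2 (gaussianWeight d) ℝ).comp (gaussianToBCF γ d)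

theorem gaussianAPP_coeFn (γ : ℕ → ℝ) (d : ℕ) (f : GaussianRKHS γ d) :
    (gaussianAPP γ d f : (Fin d → ℝ) → ℝ) =ᵐ[gaussianWeight d] fun x => f x :=
  BoundedContinuousFunction.coeFn_toLp _ _ ℝ (gaussianToBCF γ d f)

/-- The information complexity `n(ε, APP_d)` for the normalized error criterion. -/
noncomputable def gaussianInfo (γ : ℕ → ℝ) : ℝ → ℕ → ℕ∞ :=
  fun ε d => infoComplexityNOR (gaussianAPP γ d) ε

/-- `ω_γ = 2γ² / (1 + 2γ² + √(1 + 4γ²))`. -/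
noncomputable def gaussianOmega (γ : ℝ) : ℝ := 2 * γ ^ 2 / (1 + 2 * γ ^ 2 + √(1 + 4 * γ ^ 2))

/-- `r(γ) = liminf_{k → ∞} ln γ_k⁻² / ln k`, with values in `[-∞, ∞]`. -/
noncomputable def shapeDecay (γ : ℕ → ℝ) : EReal :=
  liminf (fun k : ℕ => ((Real.log (γ k ^ 2)⁻¹ / Real.log k : ℝ) : EReal)) atTop

/-! ## Minimal errors and singular values -/

section SingularValues

variable {H G : Type*} [NormedAddCommGroup H] [InnerProductSpace ℝ H]
  [NormedAddCommGroup G] [InnerProductSpace ℝ G]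

/-! The information complexity of a compact operator counts its singular values above a threshold,
so the task is to find the singular values of `APP_d` and to count them. With `a (1 + a) = γ²`, a
scaled Hermite polynomial times `exp(-a x²)` is an eigenfunction of the one-dimensional Gaussian
integral operator, with eigenvalue `(1 - ω) ω ^ n`. Tensor products give the squared singular values
`∏ (1 - ω_j) ω_j ^ k_j`. Their sum is the trace `∫ K(x,x) = 1`, so none are missing. After
normalization the factors `1 - ω_j` cancel, and `n(ε, APP_d)` is the number of multi-indices `k`
with `∏ ω_j ^ k_j > ε²` (`exists_gaussianInfo_eq_card`).

Two bounds on this number carry all the tractability results. From above, a Markov-type estimate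
with a free exponent `τ` gives `ε^(-2τ) ∏ (1 - ω_j^τ)⁻¹`, hence `ε^(-2τ) exp(c ∑ ω_j^τ)`
(`gaussianInfo_le_exp`). From below, 0-1 multi-indices with `m` ones give at least `d.choose m` as
soon as `ε² < ω_d ^ m` (`choose_le_gaussianInfo`).

For SPT take `τ = p/2`: the sum converges when `r p / 2 > 1`, and `m = 1` in the lower bound shows
that this is sharp up to the boundary case. A polynomial factor `d ^ q` is beaten by any `m > q`, so
PT already forces `r > 0`. For QPT let `τ = (t/2)(1 + ln d)`: all but finitely many terms are then
at most `1/d` if `ln ω_k⁻¹ > 2/t` eventually, and the lower bound with `m → ∞` gives the converse up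
to equality. Weak tractability follows from QPT, because a product of logarithms is dominated by any
positive power. -/

theorem worstCaseError_le {S : H →L[ℝ] G} {A : H → G} {c : ℝ}
    (h : ∀ f, ‖f‖ ≤ 1 → ‖S f - A f‖ ≤ c) : worstCaseError S A ≤ ENNReal.ofReal c :=
  iSup₂_le fun f hf => by
    rw [← ofReal_norm]
    exact ENNReal.ofReal_le_ofReal (h f hf)

theorem le_worstCaseError {S : H →L[ℝ] G} {A : H → G} {c : ℝ} {f : H} (hf : ‖f‖ ≤ 1)
    (h : c ≤ ‖S f - A f‖) : ENNReal.ofReal c ≤ worstCaseError S A := by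
  refine le_trans ?_ (le_iSup₂ (f := fun (f : H) (_ : ‖f‖ ≤ 1) => ‖S f - A f‖ₑ) f hf)
  rw [← ofReal_norm]
  exact ENNReal.ofReal_le_ofReal h

variable {ι : Type*} {S : H →L[ℝ] G} {e : ι → H} {lam : ι → ℝ}

theorem norm_sq_sum_of_orthogonal {u : ι → G} (F : Finset ι) (a : ι → ℝ)
    (hu : Pairwise fun i j => inner ℝ (u i) (u j) = 0) :
    ‖∑ i ∈ F, a i • u i‖ ^ 2 = ∑ i ∈ F, a i ^ 2 * ‖u i‖ ^ 2 := by
  classical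
  rw [← real_inner_self_eq_norm_sq, sum_inner]
  refine Finset.sum_congr rfl fun i hi => ?_
  rw [inner_sum, Finset.sum_eq_single i]
  · rw [real_inner_smul_left, real_inner_smul_right, real_inner_self_eq_norm_sq]
    ring
  · intro j _ hj
    rw [real_inner_smul_left, real_inner_smul_right, hu hj.symm]
    ring
  · exact fun h => absurd hi h

/-- Any algorithm using `n` functionals fails on a span of more than `n` singular vectors. -/
theorem exists_norm_le_one_of_card_lt {n : ℕ} (he : Orthonormal ℝ e)
    (horth : Pairwise fun i j => inner ℝ (S (e i)) (S (e j)) = 0)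
    (hlam : ∀ i, ‖S (e i)‖ ^ 2 = lam i) {F : Finset ι} (hF : n < F.card) {c : ℝ}
    (hc : ∀ i ∈ F, c ≤ lam i) (L : Fin n → (H →L[ℝ] ℝ)) :
    ∃ f : H, ‖f‖ ≤ 1 ∧ (∀ i, L i f = 0) ∧ √c ≤ ‖S f‖ := by
  classical
  let T : (F → ℝ) →ₗ[ℝ] (Fin n → ℝ) :=
    LinearMap.pi fun i => (L i).toLinearMap ∘ₗ
      Fintype.linearCombination ℝ (fun j : F => e j)
  -- There are more coefficients than functionals, so some nonzero combination of the `e j` is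
  -- invisible to all of them.
  have hker : LinearMap.ker T ≠ ⊥ := LinearMap.ker_ne_bot_of_finrank_lt (by simpa using hF)
  obtain ⟨a, haT, ha⟩ := (Submodule.ne_bot_iff _).1 hker
  set g : H := ∑ j : F, a j • e j with hg
  have hnorm : ‖g‖ ^ 2 = ∑ j : F, a j ^ 2 := by
    rw [hg, norm_sq_sum_of_orthogonal (u := fun j : F => e j) Finset.univ a
      (fun i j hij => he.2 (Subtype.coe_ne_coe.2 hij))]
    simp [he.1]
  have hSg : ‖S g‖ ^ 2 = ∑ j : F, a j ^ 2 * lam j := by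
    rw [hg, map_sum]
    simp only [map_smul]
    rw [norm_sq_sum_of_orthogonal (u := fun j : F => S (e j)) Finset.univ a
      (fun i j hij => horth (Subtype.coe_ne_coe.2 hij))]
    simp [hlam]
  have hgpos : 0 < ‖g‖ := by
    obtain ⟨j, hj⟩ := Function.ne_iff.1 ha
    have : 0 < ‖g‖ ^ 2 := by
      rw [hnorm]
      exact Finset.sum_pos' (fun _ _ => sq_nonneg _) ⟨j, Finset.mem_univ _, sq_pos_of_ne_zero hj⟩
    exact (norm_nonneg g).lt_of_ne fun h => by simp [← h] at this
  refine ⟨‖g‖⁻¹ • g, ?_, fun i => ?_, ?_⟩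
  · rw [norm_smul, norm_inv, norm_norm, inv_mul_cancel₀ hgpos.ne']
  · have : L i g = 0 := by
      have := congrFun (LinearMap.mem_ker.1 haT) i
      simpa [T, Fintype.linearCombination_apply, hg] using this
    rw [map_smul, this, smul_zero]
  · rw [map_smul, norm_smul, norm_inv, norm_norm, inv_mul_eq_div, le_div_iff₀ hgpos]
    refine abs_le_of_sq_le_sq' ?_ (norm_nonneg _) |>.2
    rw [hSg]
    by_cases hc0 : 0 ≤ c
    · rw [mul_pow, Real.sq_sqrt hc0, hnorm, Finset.mul_sum]
      exact Finset.sum_le_sum fun j _ => by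
        have := hc j j.2
        nlinarith [sq_nonneg (a j)]
    · rw [Real.sqrt_eq_zero_of_nonpos (le_of_not_ge hc0), zero_mul, zero_pow two_ne_zero,
        ← hSg]
      positivity

/-- The vectors `f` and `-f` yield the same zero information, hence the same output, while their
images are `2 ‖S f‖` apart. One of them is therefore approximated with error at least `‖S f‖`;
nonlinear `φ` does not help. -/
theorem ofReal_sqrt_le_minimalError {n : ℕ} (he : Orthonormal ℝ e)
    (horth : Pairwise fun i j => inner ℝ (S (e i)) (S (e j)) = 0)
    (hlam : ∀ i, ‖S (e i)‖ ^ 2 = lam i) {F : Finset ι} (hF : n < F.card) {c : ℝ}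
    (hc : ∀ i ∈ F, c ≤ lam i) : ENNReal.ofReal √c ≤ minimalError S n := by
  cases n with
  | zero =>
    obtain ⟨f, hf, -, h⟩ := exists_norm_le_one_of_card_lt he horth hlam hF hc Fin.elim0
    exact le_worstCaseError hf (by simpa using h)
  | succ n =>
    refine le_iInf fun L => le_iInf fun φ => le_iInf fun _ => ?_
    obtain ⟨f, hf, hL, h⟩ := exists_norm_le_one_of_card_lt he horth hlam hF hc L
    have e1 : (fun i => L i f) = 0 := funext hL
    have e2 : (fun i => L i (-f)) = 0 := funext fun i => by simp [hL]
    have h2 : 2 * ‖S f‖ ≤ ‖S f - φ 0‖ + ‖S (-f) - φ 0‖ := by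
      have := norm_sub_le (S f - φ 0) (S (-f) - φ 0)
      have e3 : S f - φ 0 - (S (-f) - φ 0) = (2 : ℝ) • S f := by
        rw [map_neg, two_smul]
        abel
      rwa [e3, norm_smul, Real.norm_two] at this
    rcases le_total (√c) ‖S f - φ 0‖ with h3 | h3
    · exact le_worstCaseError hf (by rwa [e1])
    · refine le_worstCaseError (f := -f) (by rwa [norm_neg]) ?_
      rw [e2]
      linarith

/-- Projecting on the singular vectors in `F` is an algorithm with error controlled by the
remaining singular values, if the singular vectors exhaust `S`. -/
theorem minimalError_card_le (he : Orthonormal ℝ e)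
    (horth : Pairwise fun i j => inner ℝ (S (e i)) (S (e j)) = 0)
    (hlam : ∀ i, ‖S (e i)‖ ^ 2 = lam i)
    (htail : ∀ δ : ℝ, 0 < δ → ∃ E : Finset ι, ∀ E' : Finset ι, E ⊆ E' →
      ∀ f : H, (∀ i ∈ E', inner ℝ (e i) f = 0) → ‖S f‖ ≤ δ * ‖f‖)
    (F : Finset ι) {c : ℝ} (hc0 : 0 ≤ c) (hc : ∀ i, i ∉ F → lam i ≤ c) :
    minimalError S F.card ≤ ENNReal.ofReal √c := by
  classical
  have key : ∀ f : H, ‖f‖ ≤ 1 → ‖S f - ∑ i ∈ F, inner ℝ (e i) f • S (e i)‖ ≤ √c := by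
    intro f hf
    refine le_of_forall_pos_le_add fun δ hδ => ?_
    obtain ⟨E, hE⟩ := htail δ hδ
    -- Only singular vectors outside `F` and the remainder `g` contribute to the error: the former
    -- give at most `√c` by orthogonality, the latter at most `δ`.
    set g := f - ∑ i ∈ E ∪ F, inner ℝ (e i) f • e i with hg
    have hgperp : ∀ i ∈ E ∪ F, inner ℝ (e i) g = 0 := by
      intro i hi
      rw [hg, inner_sub_right, he.inner_right_sum _ hi, sub_self]
    have hsum : ‖∑ i ∈ E ∪ F, inner ℝ (e i) f • e i‖ ^ 2 =
        ∑ i ∈ E ∪ F, inner ℝ (e i) f ^ 2 := by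
      rw [norm_sq_sum_of_orthogonal _ _ he.2]
      simp [he.1]
    have hgf : ‖g‖ ^ 2 + ∑ i ∈ E ∪ F, inner ℝ (e i) f ^ 2 = ‖f‖ ^ 2 := by
      have h0 : inner ℝ g (∑ i ∈ E ∪ F, inner ℝ (e i) f • e i) = 0 := by
        rw [inner_sum]
        refine Finset.sum_eq_zero fun i hi => ?_
        rw [real_inner_smul_right, real_inner_comm (e i) g, hgperp i hi, mul_zero]
      have h1 := norm_add_sq_eq_norm_sq_add_norm_sq_real h0
      have h2 : g + ∑ i ∈ E ∪ F, inner ℝ (e i) f • e i = f := by rw [hg]; abel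
      rw [h2] at h1
      rw [← hsum]
      nlinarith
    have hsumnn : 0 ≤ ∑ i ∈ E ∪ F, inner ℝ (e i) f ^ 2 :=
      Finset.sum_nonneg fun _ _ => sq_nonneg _
    have hg1 : ‖g‖ ≤ 1 := by
      refine abs_le_of_sq_le_sq' ?_ zero_le_one |>.2
      nlinarith [norm_nonneg f]
    have hSf : S f - ∑ i ∈ F, inner ℝ (e i) f • S (e i) =
        (∑ i ∈ (E ∪ F) \ F, inner ℝ (e i) f • S (e i)) + S g := by
      have h1 := Finset.sum_sdiff (f := fun i => inner ℝ (e i) f • S (e i))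
        (Finset.subset_union_right : F ⊆ E ∪ F)
      rw [hg, map_sub, map_sum]
      simp only [map_smul]
      rw [← h1]
      abel
    have hpart : ‖∑ i ∈ (E ∪ F) \ F, inner ℝ (e i) f • S (e i)‖ ≤ √c := by
      refine Real.le_sqrt_of_sq_le ?_
      rw [norm_sq_sum_of_orthogonal _ _ horth]
      calc ∑ i ∈ (E ∪ F) \ F, inner ℝ (e i) f ^ 2 * ‖S (e i)‖ ^ 2
          ≤ ∑ i ∈ (E ∪ F) \ F, inner ℝ (e i) f ^ 2 * c := by
            refine Finset.sum_le_sum fun i hi => ?_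
            rw [hlam]
            exact mul_le_mul_of_nonneg_left (hc i (Finset.mem_sdiff.1 hi).2) (sq_nonneg _)
        _ ≤ ∑ i ∈ E ∪ F, inner ℝ (e i) f ^ 2 * c :=
            Finset.sum_le_sum_of_subset_of_nonneg Finset.sdiff_subset fun _ _ _ => by positivity
        _ ≤ 1 * c := by
            rw [← Finset.sum_mul]
            refine mul_le_mul_of_nonneg_right ?_ hc0
            nlinarith [norm_nonneg f, sq_nonneg ‖g‖]
        _ = c := one_mul c
    rw [hSf]
    refine (norm_add_le _ _).trans (add_le_add hpart ?_)
    refine (hE _ Finset.subset_union_left g hgperp).trans ?_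
    nlinarith
  -- `minimalError S 0` is the initial error by definition, not an infimum over algorithms, so the
  -- empty `F` is separate.
  rcases Nat.eq_zero_or_pos F.card with h0 | hpos
  · rw [h0]
    rw [Finset.card_eq_zero] at h0
    subst h0
    exact worstCaseError_le fun f hf => by simpa using key f hf
  · obtain ⟨m, hm⟩ : ∃ m, F.card = m + 1 := ⟨F.card - 1, by omega⟩
    rw [hm]
    let r : Fin (m + 1) ≃ F := (F.equivFin.trans (finCongr hm)).symm
    have hφ : @Measurable _ _ _ (borel G) fun y : Fin (m + 1) → ℝ => ∑ i, y i • S (e (r i)) := by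
      borelize G
      exact Continuous.measurable (by fun_prop)
    have hle : minimalError S (m + 1) ≤
        worstCaseError S fun f => ∑ i, innerSL ℝ (e (r i)) f • S (e (r i)) := by
      rw [minimalError]
      exact iInf_le_of_le (fun i => innerSL ℝ (e (r i))) (iInf_le_of_le _ (iInf_le _ hφ))
    refine hle.trans (worstCaseError_le fun f hf => ?_)
    have h1 : ∑ i, innerSL ℝ (e (r i)) f • S (e (r i)) =
        ∑ i ∈ F, inner ℝ (e i) f • S (e i) := by
      rw [← Finset.sum_coe_sort F, ← r.sum_comp]
      rfl
    rw [h1]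
    exact key f hf

/-- The information complexity counts the singular values above the threshold. -/
theorem infoComplexityNOR_eq_card (he : Orthonormal ℝ e)
    (horth : Pairwise fun i j => inner ℝ (S (e i)) (S (e j)) = 0)
    (hlam : ∀ i, ‖S (e i)‖ ^ 2 = lam i)
    (htail : ∀ δ : ℝ, 0 < δ → ∃ E : Finset ι, ∀ E' : Finset ι, E ⊆ E' →
      ∀ f : H, (∀ i ∈ E', inner ℝ (e i) f = 0) → ‖S f‖ ≤ δ * ‖f‖)
    (i₀ : ι) (hmax : ∀ i, lam i ≤ lam i₀) {ε : ℝ} (hε : 0 < ε)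
    {F : Finset ι} (hF : ∀ i, i ∈ F ↔ ε ^ 2 * lam i₀ < lam i) :
    infoComplexityNOR S ε = F.card := by
  have hpos : 0 ≤ lam i₀ := by rw [← hlam]; positivity
  have h0 : minimalError S 0 = ENNReal.ofReal √(lam i₀) := by
    refine le_antisymm ?_ ?_
    · exact minimalError_card_le he horth hlam htail ∅ hpos fun i _ => hmax i
    · exact ofReal_sqrt_le_minimalError (F := {i₀}) he horth hlam (by simp) (by simp)
  have hthr : ENNReal.ofReal ε * minimalError S 0 = ENNReal.ofReal √(ε ^ 2 * lam i₀) := by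
    rw [h0, ← ENNReal.ofReal_mul hε.le, Real.sqrt_mul (sq_nonneg _), Real.sqrt_sq hε.le]
  rw [infoComplexityNOR, hthr]
  refine le_antisymm ?_ ?_
  · refine iInf₂_le _ ?_
    refine minimalError_card_le he horth hlam htail F (by positivity) fun i hi => ?_
    rw [hF] at hi
    exact not_lt.1 hi
  · refine le_iInf₂ fun n hn => ?_
    rw [Nat.cast_le]
    by_contra! hlt
    have hne : F.Nonempty := Finset.card_pos.1 (by omega)
    -- All of `F` lies above its smallest value `lam j`, which itself exceeds the threshold; with `n
    -- < F.card` functionals the error cannot drop below `√(lam j)`.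
    obtain ⟨j, hj, hjmin⟩ := F.exists_min_image lam hne
    have h2 := (ofReal_sqrt_le_minimalError he horth hlam hlt hjmin).trans hn
    have h3 := (hF j).1 hj
    have h4 : 0 < lam j := lt_of_le_of_lt (by positivity) h3
    rw [ENNReal.ofReal_le_ofReal_iff (Real.sqrt_nonneg _),
      Real.sqrt_le_sqrt_iff (by positivity)] at h2
    linarith

end SingularValues

/-! ## Hermite polynomials and Gaussian integrals -/

theorem integrable_polynomial_mul_gaussian (p : Polynomial ℝ) {b : ℝ} (hb : 0 < b) (c : ℝ) :
    Integrable fun y : ℝ => p.eval y * Real.exp (-(b * (y - c) ^ 2)) := by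
  have key : ∀ q : Polynomial ℝ,
      Integrable fun y : ℝ => q.eval y * Real.exp (-(b * y ^ 2)) := by
    intro q
    induction q using Polynomial.induction_on' with
    | add p q hp hq =>
      refine (hp.add hq).congr (ae_of_all _ fun y => ?_)
      simp only [Pi.add_apply, Polynomial.eval_add, add_mul]
    | monomial n r =>
      have h := (integrable_rpow_mul_exp_neg_mul_sq hb (s := n)
        (by linarith [n.cast_nonneg (α := ℝ)])).const_mul r
      refine h.congr (ae_of_all _ fun y => ?_)
      simp only [Polynomial.eval_monomial, Real.rpow_natCast, neg_mul, mul_assoc]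
  have h := (key (p.comp (Polynomial.X + Polynomial.C c))).comp_sub_right c
  refine h.congr (ae_of_all _ fun y => ?_)
  simp

theorem integral_polynomial_gaussian_by_parts (p : Polynomial ℝ) {b : ℝ} (hb : 0 < b) (c : ℝ) :
    ∫ y : ℝ, p.derivative.eval y * Real.exp (-(b * (y - c) ^ 2)) =
      2 * b * ∫ y : ℝ, ((Polynomial.X - Polynomial.C c) * p).eval y *
        Real.exp (-(b * (y - c) ^ 2)) := by
  have hd : ∀ y : ℝ, HasDerivAt (fun y : ℝ => p.eval y * Real.exp (-(b * (y - c) ^ 2)))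
      (p.derivative.eval y * Real.exp (-(b * (y - c) ^ 2)) -
        2 * b * (((Polynomial.X - Polynomial.C c) * p).eval y *
          Real.exp (-(b * (y - c) ^ 2)))) y := by
    intro y
    have h1 := ((((hasDerivAt_id y).sub_const c).pow 2).const_mul b).neg.exp
    refine ((p.hasDerivAt y).mul h1).congr_deriv ?_
    simp
    ring
  have i1 := integrable_polynomial_mul_gaussian p.derivative hb c
  have i2 := (integrable_polynomial_mul_gaussian ((Polynomial.X - Polynomial.C c) * p) hb
    c).const_mul (2 * b)
  have h := integral_eq_zero_of_hasDerivAt_of_integrable hd (i1.sub i2)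
    (integrable_polynomial_mul_gaussian p hb c)
  rw [integral_sub i1 i2, integral_const_mul] at h
  linarith

theorem integral_gaussian_sub {b : ℝ} (c : ℝ) :
    ∫ y : ℝ, Real.exp (-(b * (y - c) ^ 2)) = √(Real.pi / b) := by
  rw [integral_sub_right_eq_self (fun y : ℝ => Real.exp (-(b * y ^ 2))) c, ← integral_gaussian]
  simp only [neg_mul]

/-- The probabilists' Hermite polynomial with real coefficients. -/
noncomputable def hermiteReal (n : ℕ) : Polynomial ℝ :=
  (Polynomial.hermite n).map (Int.castRingHom ℝ)

theorem hermiteReal_zero : hermiteReal 0 = 1 := by simp [hermiteReal]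

theorem hermiteReal_succ (n : ℕ) :
    hermiteReal (n + 1) = Polynomial.X * hermiteReal n - (hermiteReal n).derivative := by
  simp [hermiteReal, Polynomial.hermite_succ, Polynomial.derivative_map]

theorem derivative_hermiteReal_succ (n : ℕ) :
    (hermiteReal (n + 1)).derivative = ((n + 1 : ℕ) : Polynomial ℝ) * hermiteReal n := by
  induction n with
  | zero => simp [hermiteReal_succ, hermiteReal_zero]
  | succ n ih =>
    have h : (hermiteReal (n + 1 + 1)).derivative = hermiteReal (n + 1) +
        (Polynomial.X * (hermiteReal (n + 1)).derivative -
          (hermiteReal (n + 1)).derivative.derivative) := by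
      rw [hermiteReal_succ (n + 1)]
      simp only [Polynomial.derivative_sub, Polynomial.derivative_mul, Polynomial.derivative_X]
      ring
    rw [h, ih]
    have h2 : (((n + 1 : ℕ) : Polynomial ℝ) * hermiteReal n).derivative =
        ((n + 1 : ℕ) : Polynomial ℝ) * (hermiteReal n).derivative := by
      simp [Polynomial.derivative_mul]
    rw [h2]
    have h3 := hermiteReal_succ n
    push_cast
    linear_combination (-(n + 1 : Polynomial ℝ)) * h3

theorem integrable_scaled_polynomial_mul_gaussian (p : Polynomial ℝ) (β : ℝ) {b : ℝ} (hb : 0 < b)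
    (c : ℝ) : Integrable fun y : ℝ => p.eval (β * y) * Real.exp (-(b * (y - c) ^ 2)) := by
  refine (integrable_polynomial_mul_gaussian (p.comp (Polynomial.C β * Polynomial.X)) hb
    c).congr (ae_of_all _ fun y => ?_)
  simp

/-- Stein's identity for mean `c` and variance `1 / (2b)`. It turns the Hermite recurrence into a
recurrence for Gaussian averages. -/
theorem integral_scaled_polynomial_gaussian_by_parts (p : Polynomial ℝ) (β : ℝ) {b : ℝ}
    (hb : 0 < b) (c : ℝ) :
    ∫ y : ℝ, (Polynomial.X * p).eval (β * y) * Real.exp (-(b * (y - c) ^ 2)) =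
      β * c * (∫ y : ℝ, p.eval (β * y) * Real.exp (-(b * (y - c) ^ 2))) +
      β ^ 2 / (2 * b) * ∫ y : ℝ, p.derivative.eval (β * y) * Real.exp (-(b * (y - c) ^ 2)) := by
  have h := integral_polynomial_gaussian_by_parts (p.comp (Polynomial.C β * Polynomial.X)) hb c
  have e1 : ∫ y : ℝ, (p.comp (Polynomial.C β * Polynomial.X)).derivative.eval y *
      Real.exp (-(b * (y - c) ^ 2)) =
      β * ∫ y : ℝ, p.derivative.eval (β * y) * Real.exp (-(b * (y - c) ^ 2)) := by
    rw [← integral_const_mul]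
    congr 1
    ext y
    simp [Polynomial.derivative_comp]
    ring
  have e2 : β * ∫ y : ℝ, ((Polynomial.X - Polynomial.C c) *
      p.comp (Polynomial.C β * Polynomial.X)).eval y * Real.exp (-(b * (y - c) ^ 2)) =
      (∫ y : ℝ, (Polynomial.X * p).eval (β * y) * Real.exp (-(b * (y - c) ^ 2))) -
      β * c * ∫ y : ℝ, p.eval (β * y) * Real.exp (-(b * (y - c) ^ 2)) := by
    rw [← integral_const_mul, ← integral_const_mul, ← integral_sub
      (integrable_scaled_polynomial_mul_gaussian _ β hb c)
      ((integrable_scaled_polynomial_mul_gaussian _ β hb c).const_mul _)]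
    congr 1
    ext y
    simp
    ring
  rw [e1] at h
  have e3 : β ^ 2 / (2 * b) * ∫ y : ℝ, p.derivative.eval (β * y) *
      Real.exp (-(b * (y - c) ^ 2)) = β * ∫ y : ℝ, ((Polynomial.X - Polynomial.C c) *
      p.comp (Polynomial.C β * Polynomial.X)).eval y * Real.exp (-(b * (y - c) ^ 2)) := by
    rw [div_mul_eq_mul_div, div_eq_iff (by positivity)]
    linear_combination β * h
  rw [e3, e2]
  ring

/-- The Gaussian average of a scaled Hermite polynomial. -/
theorem integral_hermiteReal_gaussian {b β ω : ℝ} (hb : 0 < b)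
    (h : β ^ 2 / (2 * b) = 1 - ω ^ 2) (x : ℝ) (n : ℕ) :
    ∫ y : ℝ, (hermiteReal n).eval (β * y) * Real.exp (-(b * (y - ω * x) ^ 2)) =
      ω ^ n * (hermiteReal n).eval (β * x) * √(Real.pi / b) := by
  induction n using Nat.strong_induction_on with
  | _ n ih =>
    match n with
    | 0 => simp [hermiteReal_zero, integral_gaussian_sub]
    | 1 =>
      have h1 := integral_scaled_polynomial_gaussian_by_parts 1 β hb (ω * x)
      simp [integral_gaussian_sub] at h1
      simp only [hermiteReal_succ, hermiteReal_zero, mul_one, Polynomial.derivative_one,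
        sub_zero, Polynomial.eval_X, h1, pow_one]
      ring
    | n + 2 =>
      rw [hermiteReal_succ (n + 1)]
      -- The derivative term has coefficient `(1 - ω²) - 1 = -ω²`, so the averages obey the
      -- recurrence of `ω ^ n` times the Hermite polynomials.
      have h1 := integral_scaled_polynomial_gaussian_by_parts (hermiteReal (n + 1)) β hb (ω * x)
      have e : ∫ y : ℝ, (hermiteReal (n + 1)).derivative.eval (β * y) *
          Real.exp (-(b * (y - ω * x) ^ 2)) =
          (n + 1) * (ω ^ n * (hermiteReal n).eval (β * x) * √(Real.pi / b)) := by
        rw [← ih n (by omega), ← integral_const_mul]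
        congr 1
        ext y
        rw [derivative_hermiteReal_succ]
        simp
        ring
      simp only [Polynomial.eval_sub, sub_mul]
      rw [integral_sub (integrable_scaled_polynomial_mul_gaussian _ β hb _)
        (integrable_scaled_polynomial_mul_gaussian _ β hb _), h1, e, h, ih (n + 1) (by omega),
        derivative_hermiteReal_succ]
      simp
      ring

/-- Orthogonality of the scaled Hermite polynomials. -/
theorem integral_hermiteReal_mul_hermiteReal {b β : ℝ} (hb : 0 < b) (h : β ^ 2 = 2 * b)
    (m n : ℕ) :
    ∫ y : ℝ, (hermiteReal m).eval (β * y) * (hermiteReal n).eval (β * y) *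
      Real.exp (-(b * y ^ 2)) = if m = n then m.factorial * √(Real.pi / b) else 0 := by
  -- For `β² = 2b` the raising operator `X - d/dX` is adjoint to `d/dX`; both degrees then go down
  -- together.
  have key : ∀ (m : ℕ) (q : Polynomial ℝ),
      ∫ y : ℝ, (hermiteReal (m + 1)).eval (β * y) * q.eval (β * y) * Real.exp (-(b * y ^ 2)) =
      ∫ y : ℝ, (hermiteReal m).eval (β * y) * q.derivative.eval (β * y) *
        Real.exp (-(b * y ^ 2)) := by
    intro m q
    have h1 := integral_scaled_polynomial_gaussian_by_parts (hermiteReal m * q) β hb 0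
    have e1 : β ^ 2 / (2 * b) = 1 := by rw [h, div_self (by positivity)]
    rw [e1] at h1
    simp only [sub_zero, mul_zero, zero_mul, zero_add, one_mul] at h1
    have i1 := integrable_scaled_polynomial_mul_gaussian (Polynomial.X * (hermiteReal m * q)) β hb 0
    have i2 := integrable_scaled_polynomial_mul_gaussian ((hermiteReal m).derivative * q) β hb 0
    have i3 := integrable_scaled_polynomial_mul_gaussian (hermiteReal m * q.derivative) β hb 0
    simp only [sub_zero] at i1 i2 i3
    have e2 : ∫ y : ℝ, (hermiteReal m * q).derivative.eval (β * y) * Real.exp (-(b * y ^ 2)) =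
        (∫ y : ℝ, ((hermiteReal m).derivative * q).eval (β * y) * Real.exp (-(b * y ^ 2))) +
        ∫ y : ℝ, (hermiteReal m * q.derivative).eval (β * y) * Real.exp (-(b * y ^ 2)) := by
      rw [← integral_add i2 i3]
      congr 1
      ext y
      simp [Polynomial.derivative_mul]
      ring
    have e3 : ∫ y : ℝ, (hermiteReal (m + 1)).eval (β * y) * q.eval (β * y) *
        Real.exp (-(b * y ^ 2)) =
        (∫ y : ℝ, (Polynomial.X * (hermiteReal m * q)).eval (β * y) * Real.exp (-(b * y ^ 2))) -
        ∫ y : ℝ, ((hermiteReal m).derivative * q).eval (β * y) * Real.exp (-(b * y ^ 2)) := by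
      rw [← integral_sub i1 i2]
      congr 1
      ext y
      rw [hermiteReal_succ]
      simp
      ring
    rw [e3, h1, e2]
    simp
  induction m generalizing n with
  | zero =>
    cases n with
    | zero =>
      have := integral_gaussian_sub (b := b) 0
      simpa [hermiteReal_zero] using this
    | succ n =>
      have := key n 1
      simpa [hermiteReal_zero] using this
  | succ m ih =>
    rw [key]
    cases n with
    | zero => simp [hermiteReal_zero]
    | succ n =>
      have : ∀ y : ℝ, (hermiteReal m).eval (β * y) *
          (hermiteReal (n + 1)).derivative.eval (β * y) * Real.exp (-(b * y ^ 2)) =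
          (n + 1) * ((hermiteReal m).eval (β * y) * (hermiteReal n).eval (β * y) *
            Real.exp (-(b * y ^ 2))) := by
        intro y
        rw [derivative_hermiteReal_succ]
        simp
        ring
      simp only [this]
      rw [integral_const_mul, ih]
      by_cases hmn : m = n
      · subst hmn
        simp [Nat.factorial_succ]
        ring
      · simp [hmn]

/-! ## Eigenfunctions of the one-dimensional Gaussian kernel -/

/-- The positive root `a` of `a (1 + a) = γ²`. -/
noncomputable def gaussianRate (γ : ℝ) : ℝ := (√(1 + 4 * γ ^ 2) - 1) / 2

theorem gaussianRate_nonneg (γ : ℝ) : 0 ≤ gaussianRate γ := by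
  have : 1 ≤ √(1 + 4 * γ ^ 2) := Real.one_le_sqrt.2 (by nlinarith [sq_nonneg γ])
  unfold gaussianRate
  linarith

theorem gaussianRate_mul (γ : ℝ) : gaussianRate γ * (1 + gaussianRate γ) = γ ^ 2 := by
  have := Real.sq_sqrt (show 0 ≤ 1 + 4 * γ ^ 2 by positivity)
  unfold gaussianRate
  linear_combination this / 4

theorem gaussianRate_pos {γ : ℝ} (h : 0 < γ ^ 2) : 0 < gaussianRate γ := by
  refine (gaussianRate_nonneg γ).lt_of_ne fun h0 => ?_
  rw [← gaussianRate_mul, ← h0] at h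
  simp at h

theorem gaussianOmega_eq (γ : ℝ) : gaussianOmega γ = gaussianRate γ / (1 + gaussianRate γ) := by
  have h0 := gaussianRate_nonneg γ
  have h1 := gaussianRate_mul γ
  have h2 : √(1 + 4 * γ ^ 2) = 1 + 2 * gaussianRate γ := by unfold gaussianRate; ring
  rw [gaussianOmega, h2, ← h1]
  rw [div_eq_div_iff (by positivity) (by positivity)]
  ring

theorem gaussianOmega_pos {γ : ℝ} (h : 0 < γ ^ 2) : 0 < gaussianOmega γ := by
  have := gaussianRate_pos h
  rw [gaussianOmega_eq]
  positivity

theorem gaussianOmega_lt_one (γ : ℝ) : gaussianOmega γ < 1 := by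
  have := gaussianRate_nonneg γ
  rw [gaussianOmega_eq, div_lt_one (by positivity)]
  linarith

/-- The `n`th eigenfunction, before normalization. -/
noncomputable def gaussianEigenfun (γ : ℝ) (n : ℕ) (x : ℝ) : ℝ :=
  (hermiteReal n).eval (√(2 * (1 + 2 * gaussianRate γ)) * x) *
    Real.exp (-(gaussianRate γ * x ^ 2))

theorem continuous_gaussianEigenfun (γ : ℝ) (n : ℕ) : Continuous (gaussianEigenfun γ n) := by
  unfold gaussianEigenfun
  fun_prop

/-- Two factors `exp(-a x²)` and the weight combine to rate `b = 1 + 2a`. The Hermite scaling `√(2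
(1 + 2a))` is the one with `β² = 2b`, as orthogonality needs. -/
theorem gaussianEigenfun_mul_mul_weight (γ : ℝ) (m n : ℕ) (x : ℝ) :
    gaussianEigenfun γ m x * gaussianEigenfun γ n x * (Real.exp (-x ^ 2) / √Real.pi) =
      (hermiteReal m).eval (√(2 * (1 + 2 * gaussianRate γ)) * x) *
      (hermiteReal n).eval (√(2 * (1 + 2 * gaussianRate γ)) * x) *
      Real.exp (-((1 + 2 * gaussianRate γ) * x ^ 2)) / √Real.pi := by
  have : Real.exp (-((1 + 2 * gaussianRate γ) * x ^ 2)) = Real.exp (-(gaussianRate γ * x ^ 2)) *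
      Real.exp (-(gaussianRate γ * x ^ 2)) * Real.exp (-x ^ 2) := by
    rw [← Real.exp_add, ← Real.exp_add]
    ring_nf
  rw [this, gaussianEigenfun, gaussianEigenfun]
  ring

theorem integrable_gaussianEigenfun_mul (γ : ℝ) (m n : ℕ) :
    Integrable fun x : ℝ =>
      gaussianEigenfun γ m x * gaussianEigenfun γ n x * (Real.exp (-x ^ 2) / √Real.pi) := by
  have h0 := gaussianRate_nonneg γ
  simp only [gaussianEigenfun_mul_mul_weight]
  have := integrable_scaled_polynomial_mul_gaussian (hermiteReal m * hermiteReal n)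
    (√(2 * (1 + 2 * gaussianRate γ))) (b := 1 + 2 * gaussianRate γ) (by positivity) 0
  simp only [sub_zero, Polynomial.eval_mul] at this
  exact this.div_const _

theorem integral_gaussianEigenfun_mul (γ : ℝ) (m n : ℕ) :
    ∫ x : ℝ, gaussianEigenfun γ m x * gaussianEigenfun γ n x * (Real.exp (-x ^ 2) / √Real.pi) =
      if m = n then m.factorial / √(1 + 2 * gaussianRate γ) else 0 := by
  have h0 := gaussianRate_nonneg γ
  simp only [gaussianEigenfun_mul_mul_weight]
  rw [integral_div, integral_hermiteReal_mul_hermiteReal (by positivity)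
    (Real.sq_sqrt (by positivity))]
  have : √Real.pi ≠ 0 := (Real.sqrt_pos.2 Real.pi_pos).ne'
  split_ifs
  · rw [Real.sqrt_div Real.pi_pos.le]
    field_simp
  · simp

/-- The eigenvalue equation for the integral operator with the Gaussian kernel. -/
theorem integral_gaussian_mul_gaussianEigenfun (γ : ℝ) (n : ℕ) (x : ℝ) :
    ∫ y : ℝ, Real.exp (-(γ ^ 2 * (x - y) ^ 2)) * gaussianEigenfun γ n y *
      (Real.exp (-y ^ 2) / √Real.pi) =
      (1 - gaussianOmega γ) * gaussianOmega γ ^ n * gaussianEigenfun γ n x := by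
  set a := gaussianRate γ with ha
  have h0 : 0 ≤ a := gaussianRate_nonneg γ
  have h1 : a * (1 + a) = γ ^ 2 := gaussianRate_mul γ
  have hω : gaussianOmega γ = a / (1 + a) := gaussianOmega_eq γ
  have ha1 : 1 + a ≠ 0 := by positivity
  -- The variance condition is `(1 + 2a) / (1 + a)² = 1 - (a / (1 + a))²`.
  have h2 := integral_hermiteReal_gaussian (b := (1 + a) ^ 2) (β := √(2 * (1 + 2 * a)))
    (ω := a / (1 + a)) (by positivity)
    (by rw [Real.sq_sqrt (by positivity)]; field_simp; ring) x n
  have e : ∀ y : ℝ, Real.exp (-(γ ^ 2 * (x - y) ^ 2)) * gaussianEigenfun γ n y *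
      (Real.exp (-y ^ 2) / √Real.pi) = Real.exp (-(a * x ^ 2)) / √Real.pi *
      ((hermiteReal n).eval (√(2 * (1 + 2 * a)) * y) *
        Real.exp (-((1 + a) ^ 2 * (y - a / (1 + a) * x) ^ 2))) := by
    intro y
    -- Completing the square in `y`: `γ² (x - y)² + a y² + y² = a x² + (1 + a)² (y - a x / (1 +
    -- a))²`, by `γ² = a (1 + a)`.
    have : Real.exp (-(a * x ^ 2)) * Real.exp (-((1 + a) ^ 2 * (y - a / (1 + a) * x) ^ 2)) =
        Real.exp (-(γ ^ 2 * (x - y) ^ 2)) * Real.exp (-(a * y ^ 2)) * Real.exp (-y ^ 2) := by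
      rw [← Real.exp_add, ← Real.exp_add, ← Real.exp_add, ← h1]
      congr 1
      field_simp
      ring
    rw [gaussianEigenfun, ← ha]
    linear_combination (-(hermiteReal n).eval (√(2 * (1 + 2 * a)) * y) / √Real.pi) * this
  simp only [e]
  rw [integral_const_mul, h2, hω, gaussianEigenfun, ← ha, Real.sqrt_div Real.pi_pos.le,
    Real.sqrt_sq (by positivity)]
  have : √Real.pi ≠ 0 := (Real.sqrt_pos.2 Real.pi_pos).ne'
  field_simp
  ring

/-! ## The singular value decomposition of the Gaussian embedding -/

theorem integral_gaussianWeight {d : ℕ} (f : (Fin d → ℝ) → ℝ) :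
    ∫ x, f x ∂gaussianWeight d =
      ∫ x, f x * ∏ j : Fin d, (Real.exp (-(x j) ^ 2) / √Real.pi) := by
  have hnn : ∀ x : Fin d → ℝ, 0 ≤ ∏ j : Fin d, (Real.exp (-(x j) ^ 2) / √Real.pi) :=
    fun x => Finset.prod_nonneg fun _ _ => by positivity
  rw [gaussianWeight, integral_withDensity_eq_integral_toReal_smul (by fun_prop)
    (ae_of_all _ fun _ => ENNReal.ofReal_lt_top)]
  refine integral_congr_ae (ae_of_all _ fun x => ?_)
  simp only [smul_eq_mul, ENNReal.toReal_ofReal (hnn x)]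
  ring

theorem integral_prod_gaussianWeight {d : ℕ} (g : Fin d → ℝ → ℝ) :
    ∫ x, ∏ j, g j (x j) ∂gaussianWeight d =
      ∏ j, ∫ y : ℝ, g j y * (Real.exp (-y ^ 2) / √Real.pi) := by
  rw [integral_gaussianWeight, ← integral_fintype_prod_volume_eq_prod]
  simp only [Finset.prod_mul_distrib]

theorem integrable_prod_gaussianWeight {d : ℕ} {g : Fin d → ℝ → ℝ}
    (hg : ∀ j, Integrable fun y : ℝ => g j y * (Real.exp (-y ^ 2) / √Real.pi)) :
    Integrable (fun x : Fin d → ℝ => ∏ j, g j (x j)) (gaussianWeight d) := by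
  have hnn : ∀ x : Fin d → ℝ, 0 ≤ ∏ j : Fin d, (Real.exp (-(x j) ^ 2) / √Real.pi) :=
    fun x => Finset.prod_nonneg fun _ _ => by positivity
  rw [gaussianWeight, integrable_withDensity_iff (by fun_prop)
    (ae_of_all _ fun _ => ENNReal.ofReal_lt_top)]
  refine (Integrable.fintype_prod (f := fun j y => g j y * (Real.exp (-y ^ 2) / √Real.pi))
    hg).congr (ae_of_all _ fun x => ?_)
  simp only [ENNReal.toReal_ofReal (hnn x), Finset.prod_mul_distrib]

theorem integral_one_gaussianWeight (d : ℕ) : ∫ _, (1 : ℝ) ∂gaussianWeight d = 1 := by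
  have h := integral_prod_gaussianWeight (d := d) fun _ _ => (1 : ℝ)
  have h1 : ∫ y : ℝ, (1 : ℝ) * (Real.exp (-y ^ 2) / √Real.pi) = 1 := by
    have := integral_gaussian 1
    simp only [neg_mul, one_mul, div_one] at this
    simp only [one_mul]
    rw [integral_div, this, div_self (Real.sqrt_pos.2 Real.pi_pos).ne']
  simpa only [h1, Finset.prod_const_one] using h

/-- Tensor products of the one-dimensional eigenfunctions. -/
noncomputable def gaussianEigenprod (γ : ℕ → ℝ) {d : ℕ} (k : Fin d → ℕ) (x : Fin d → ℝ) : ℝ :=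
  ∏ j : Fin d, gaussianEigenfun (γ (j + 1)) (k j) (x j)

/-- The squared singular values of the Gaussian embedding. -/
noncomputable def gaussianEigenvalue (γ : ℕ → ℝ) {d : ℕ} (k : Fin d → ℕ) : ℝ :=
  ∏ j : Fin d, ((1 - gaussianOmega (γ (j + 1))) * gaussianOmega (γ (j + 1)) ^ k j)

theorem continuous_gaussianEigenprod (γ : ℕ → ℝ) {d : ℕ} (k : Fin d → ℕ) :
    Continuous (gaussianEigenprod γ k) :=
  continuous_finsetProd _ fun j _ =>
    (continuous_gaussianEigenfun _ _).comp (continuous_apply j)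

theorem memLp_gaussianEigenprod (γ : ℕ → ℝ) {d : ℕ} (k : Fin d → ℕ) :
    MemLp (gaussianEigenprod γ k) 2 (gaussianWeight d) := by
  rw [memLp_two_iff_integrable_sq (continuous_gaussianEigenprod γ k).aestronglyMeasurable]
  have := integrable_prod_gaussianWeight (d := d)
    (g := fun j y => gaussianEigenfun (γ (j + 1)) (k j) y * gaussianEigenfun (γ (j + 1)) (k j) y)
    fun j => integrable_gaussianEigenfun_mul _ _ _
  refine this.congr (ae_of_all _ fun x => ?_)
  simp only [gaussianEigenprod, sq, Finset.prod_mul_distrib]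

/-- The class of `gaussianEigenprod γ k` in `L₂`. -/
noncomputable def gaussianEigenvector (γ : ℕ → ℝ) {d : ℕ} (k : Fin d → ℕ) :
    Lp ℝ 2 (gaussianWeight d) :=
  (memLp_gaussianEigenprod γ k).toLp

theorem inner_gaussianEigenvector (γ : ℕ → ℝ) {d : ℕ} (k l : Fin d → ℕ) :
    inner ℝ (gaussianEigenvector γ k) (gaussianEigenvector γ l) =
      ∏ j : Fin d, if k j = l j then
        ((k j).factorial / √(1 + 2 * gaussianRate (γ (j + 1))) : ℝ) else 0 := by
  simp only [← integral_gaussianEigenfun_mul]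
  rw [← integral_prod_gaussianWeight fun j y =>
    gaussianEigenfun (γ (j + 1)) (k j) y * gaussianEigenfun (γ (j + 1)) (l j) y, L2.inner_def]
  refine integral_congr_ae ?_
  filter_upwards [(memLp_gaussianEigenprod γ k).coeFn_toLp,
    (memLp_gaussianEigenprod γ l).coeFn_toLp] with x h1 h2
  rw [gaussianEigenvector, gaussianEigenvector, h1, h2]
  simp [gaussianEigenprod, Finset.prod_mul_distrib, mul_comm]

theorem inner_gaussianEigenvector_of_ne (γ : ℕ → ℝ) {d : ℕ} {k l : Fin d → ℕ} (h : k ≠ l) :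
    inner ℝ (gaussianEigenvector γ k) (gaussianEigenvector γ l) = 0 := by
  obtain ⟨j, hj⟩ := Function.ne_iff.1 h
  rw [inner_gaussianEigenvector]
  exact Finset.prod_eq_zero (Finset.mem_univ j) (if_neg hj)

theorem norm_gaussianEigenvector_pos (γ : ℕ → ℝ) {d : ℕ} (k : Fin d → ℕ) :
    0 < ‖gaussianEigenvector γ k‖ := by
  have h : 0 < ‖gaussianEigenvector γ k‖ ^ 2 := by
    rw [← real_inner_self_eq_norm_sq, inner_gaussianEigenvector]
    refine Finset.prod_pos fun j _ => ?_
    have := gaussianRate_nonneg (γ (j + 1))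
    rw [if_pos rfl]
    positivity
  exact (norm_nonneg _).lt_of_ne fun h0 => by simp [← h0] at h

/-- Pairing with the kernel section at `x` shows that the adjoint is integration against the kernel.
Kernel, weight and eigenfunction are all products, so the one-dimensional eigenvalue equation
applies in each coordinate. -/
theorem adjoint_gaussianAPP_eigenvector (γ : ℕ → ℝ) {d : ℕ} (k : Fin d → ℕ) (x : Fin d → ℝ) :
    (ContinuousLinearMap.adjoint (gaussianAPP γ d) (gaussianEigenvector γ k) :
      GaussianRKHS γ d) x = gaussianEigenvalue γ k * gaussianEigenprod γ k x := by
  have h1 := RKHS.kerFun_inner (𝕜 := ℝ) (V := ℝ) x (1 : ℝ)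
    (ContinuousLinearMap.adjoint (gaussianAPP γ d) (gaussianEigenvector γ k))
  rw [ContinuousLinearMap.adjoint_inner_right] at h1
  have h2 : inner ℝ (1 : ℝ) ((ContinuousLinearMap.adjoint (gaussianAPP γ d)
      (gaussianEigenvector γ k) : GaussianRKHS γ d) x) =
      (ContinuousLinearMap.adjoint (gaussianAPP γ d) (gaussianEigenvector γ k) :
      GaussianRKHS γ d) x := by simp
  rw [← h2, ← h1, L2.inner_def, gaussianEigenvalue, gaussianEigenprod, ← Finset.prod_mul_distrib]
  simp only [← integral_gaussian_mul_gaussianEigenfun]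
  rw [← integral_prod_gaussianWeight fun j y =>
    Real.exp (-(γ (j + 1) ^ 2 * (x j - y) ^ 2)) * gaussianEigenfun (γ (j + 1)) (k j) y]
  refine integral_congr_ae ?_
  filter_upwards [(memLp_gaussianEigenprod γ k).coeFn_toLp,
    gaussianAPP_coeFn γ d (RKHS.kerFun (GaussianRKHS γ d) x 1)] with y h3 h4
  rw [gaussianEigenvector, h3, h4, RKHS.kerFun_apply, RKHS.OfKernel.kernel_ofKernel]
  have : ∀ j, (y j - x j) ^ 2 = (x j - y j) ^ 2 := fun j => by ring
  simp [gaussianKernel, gaussianEigenprod, Finset.prod_mul_distrib, mul_comm, this]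

theorem gaussianAPP_adjoint_eigenvector (γ : ℕ → ℝ) {d : ℕ} (k : Fin d → ℕ) :
    gaussianAPP γ d (ContinuousLinearMap.adjoint (gaussianAPP γ d) (gaussianEigenvector γ k)) =
      gaussianEigenvalue γ k • gaussianEigenvector γ k := by
  refine Lp.ext ?_
  filter_upwards [(memLp_gaussianEigenprod γ k).coeFn_toLp, gaussianAPP_coeFn γ d
    (ContinuousLinearMap.adjoint (gaussianAPP γ d) (gaussianEigenvector γ k)),
    Lp.coeFn_smul (gaussianEigenvalue γ k) (gaussianEigenvector γ k)] with y h1 h2 h3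
  rw [h2, h3, adjoint_gaussianAPP_eigenvector, Pi.smul_apply, gaussianEigenvector, h1,
    smul_eq_mul]

theorem gaussianEigenvalue_pos {γ : ℕ → ℝ} (hpos : ∀ k : ℕ, 1 ≤ k → 0 < γ k ^ 2) {d : ℕ}
    (k : Fin d → ℕ) : 0 < gaussianEigenvalue γ k :=
  Finset.prod_pos fun j _ => mul_pos (sub_pos.2 (gaussianOmega_lt_one _))
    (pow_pos (gaussianOmega_pos (hpos _ (by omega))) _)

theorem gaussianEigenvalue_eq (γ : ℕ → ℝ) {d : ℕ} (k : Fin d → ℕ) :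
    gaussianEigenvalue γ k = gaussianEigenvalue γ (0 : Fin d → ℕ) *
      ∏ j : Fin d, gaussianOmega (γ (j + 1)) ^ k j := by
  simp [gaussianEigenvalue, Finset.prod_mul_distrib]

/-- A product of finite geometric sums. It tends to the full trace `1` as `N → ∞`, provided the
`ω_j` lie in `[0, 1)`. -/
theorem sum_gaussianEigenvalue (γ : ℕ → ℝ) (d N : ℕ) :
    ∑ k ∈ Fintype.piFinset fun _ : Fin d => Finset.range N, gaussianEigenvalue γ k =
      ∏ j : Fin d, (1 - gaussianOmega (γ (j + 1)) ^ N) := by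
  simp only [gaussianEigenvalue]
  rw [← Finset.prod_univ_sum (fun _ : Fin d => Finset.range N)
    fun j i => (1 - gaussianOmega (γ (j + 1))) * gaussianOmega (γ (j + 1)) ^ i]
  refine Finset.prod_congr rfl fun j _ => ?_
  rw [← Finset.mul_sum, mul_neg_geom_sum]

/-- Passing from eigenvectors of `S S*` to singular vectors of `S`. -/
theorem orthonormal_singularVectors {H G ι : Type*} [NormedAddCommGroup H]
    [InnerProductSpace ℝ H] [CompleteSpace H] [NormedAddCommGroup G] [InnerProductSpace ℝ G]
    [CompleteSpace G] {S : H →L[ℝ] G} {u : ι → G} {lam : ι → ℝ} (hu : ∀ i, 0 < ‖u i‖)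
    (horth : ∀ i j, i ≠ j → inner ℝ (u i) (u j) = 0) (hlam : ∀ i, 0 < lam i)
    (hS : ∀ i, S (ContinuousLinearMap.adjoint S (u i)) = lam i • u i) :
    ∃ e : ι → H, Orthonormal ℝ e ∧
      (Pairwise fun i j => inner ℝ (S (e i)) (S (e j)) = 0) ∧ ∀ i, ‖S (e i)‖ ^ 2 = lam i := by
  -- The normalization comes from `‖S* u‖² = ⟨S S* u, u⟩ = lam ‖u‖²`.
  refine ⟨fun i => (√(lam i) * ‖u i‖)⁻¹ • ContinuousLinearMap.adjoint S (u i), ⟨fun i => ?_,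
    fun i j hij => ?_⟩, fun i j hij => ?_, fun i => ?_⟩
  · have h1 : ‖ContinuousLinearMap.adjoint S (u i)‖ ^ 2 = (√(lam i) * ‖u i‖) ^ 2 := by
      rw [← real_inner_self_eq_norm_sq, ContinuousLinearMap.adjoint_inner_right, hS,
        real_inner_smul_left, real_inner_self_eq_norm_sq, mul_pow, Real.sq_sqrt (hlam i).le]
    have h2 : 0 < √(lam i) * ‖u i‖ := mul_pos (Real.sqrt_pos.2 (hlam i)) (hu i)
    rw [pow_left_inj₀ (norm_nonneg _) h2.le two_ne_zero] at h1
    rw [norm_smul, h1, norm_inv, Real.norm_of_nonneg h2.le, inv_mul_cancel₀ h2.ne']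
  · simp only
    rw [real_inner_smul_left, real_inner_smul_right, ContinuousLinearMap.adjoint_inner_right, hS,
      real_inner_smul_left, horth i j hij]
    simp
  · simp only [map_smul, hS]
    simp [real_inner_smul_left, real_inner_smul_right, horth i j hij]
  · have h2 : 0 < √(lam i) * ‖u i‖ := mul_pos (Real.sqrt_pos.2 (hlam i)) (hu i)
    simp only [map_smul, hS]
    rw [norm_smul, norm_smul, norm_inv, Real.norm_of_nonneg h2.le, Real.norm_of_nonneg (hlam i).le]
    have h3 := Real.sq_sqrt (hlam i).le
    have h4 := (Real.sqrt_pos.2 (hlam i)).ne'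
    have h5 := (hu i).ne'
    field_simp
    rw [h3, sq]

/-! ### Completeness of the singular system by a trace argument. -/

theorem norm_gaussianAPP_sq (γ : ℕ → ℝ) {d : ℕ} (f : GaussianRKHS γ d) :
    ‖gaussianAPP γ d f‖ ^ 2 = ∫ x, f x ^ 2 ∂gaussianWeight d := by
  rw [← real_inner_self_eq_norm_sq, L2.inner_def]
  refine integral_congr_ae ?_
  filter_upwards [gaussianAPP_coeFn γ d f] with x hx
  rw [hx]
  simp [sq]

theorem integrable_gaussianRKHS_sq (γ : ℕ → ℝ) {d : ℕ} (f : GaussianRKHS γ d) :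
    Integrable (fun x => f x ^ 2) (gaussianWeight d) := by
  refine Integrable.of_bound (C := ‖f‖ ^ 2)
    ((gaussianRKHS_continuous f).pow 2).aestronglyMeasurable (ae_of_all _ fun x => ?_)
  rw [norm_pow]
  exact pow_le_pow_left₀ (norm_nonneg _) (gaussianRKHS_norm_apply_le f x) 2

/-- A pointwise Bessel inequality, from the reproducing property. -/
theorem gaussianRKHS_apply_sq_le (γ : ℕ → ℝ) {d : ℕ} {ι : Type*} {e : ι → GaussianRKHS γ d}
    (he : Orthonormal ℝ e) (E : Finset ι) {f : GaussianRKHS γ d}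
    (hf : ∀ i ∈ E, inner ℝ (e i) f = 0) (x : Fin d → ℝ) :
    f x ^ 2 ≤ (1 - ∑ i ∈ E, e i x ^ 2) * ‖f‖ ^ 2 := by
  set K : GaussianRKHS γ d := RKHS.kerFun (GaussianRKHS γ d) x 1 with hK
  have happ : ∀ g : GaussianRKHS γ d, inner ℝ K g = g x := fun g => by simp [hK]
  have hKK : inner ℝ K K = (1 : ℝ) := by
    rw [happ, hK, RKHS.kerFun_apply, RKHS.OfKernel.kernel_ofKernel]
    simp [gaussianKernel]
  set r := K - ∑ i ∈ E, e i x • e i with hr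
  have h1 : inner ℝ r f = f x := by
    rw [hr, inner_sub_left, happ, sum_inner, Finset.sum_eq_zero, sub_zero]
    intro i hi
    rw [real_inner_smul_left, hf i hi, mul_zero]
  have h2 : ‖r‖ ^ 2 = 1 - ∑ i ∈ E, e i x ^ 2 := by
    rw [hr, norm_sub_sq_real, ← real_inner_self_eq_norm_sq, hKK,
      norm_sq_sum_of_orthogonal _ _ he.2, inner_sum]
    have h3 : ∀ i ∈ E, inner ℝ K (e i x • e i) = e i x ^ 2 := fun i _ => by
      rw [real_inner_smul_right, happ, sq]
    rw [Finset.sum_congr rfl h3]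
    simp only [he.1, one_pow, mul_one]
    ring
  have h3 := abs_real_inner_le_norm r f
  rw [h1] at h3
  rw [← h2, ← mul_pow, ← sq_abs]
  exact pow_le_pow_left₀ (abs_nonneg _) h3 2

/-- Integrating the pointwise Bessel inequality bounds the squared norm of the embedding on the
orthogonal complement by the part of the trace not yet accounted for. Exhausting the trace thus
replaces a density argument for Hermite functions. -/
theorem norm_gaussianAPP_sq_le (γ : ℕ → ℝ) {d : ℕ} {ι : Type*} {e : ι → GaussianRKHS γ d}
    (he : Orthonormal ℝ e) (E : Finset ι) {f : GaussianRKHS γ d}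
    (hf : ∀ i ∈ E, inner ℝ (e i) f = 0) :
    ‖gaussianAPP γ d f‖ ^ 2 ≤ (1 - ∑ i ∈ E, ‖gaussianAPP γ d (e i)‖ ^ 2) * ‖f‖ ^ 2 := by
  simp only [norm_gaussianAPP_sq]
  have hs : Integrable (fun x => ∑ i ∈ E, e i x ^ 2) (gaussianWeight d) :=
    integrable_finsetSum _ fun i _ => integrable_gaussianRKHS_sq γ (e i)
  have h := integral_mono (integrable_gaussianRKHS_sq γ f)
    (((integrable_const (1 : ℝ)).sub hs).mul_const (‖f‖ ^ 2))
    fun x => gaussianRKHS_apply_sq_le γ he E hf x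
  refine h.trans_eq ?_
  simp only [Pi.sub_apply]
  rw [integral_mul_const, integral_sub (integrable_const _) hs, integral_one_gaussianWeight,
    integral_finsetSum _ fun i _ => integrable_gaussianRKHS_sq γ (e i)]

/-- The largest singular value belongs to `k = 0`, and dividing by it removes the common factor `∏
(1 - ω_j)`. -/
theorem gaussianInfo_eq_card {γ : ℕ → ℝ} (hpos : ∀ k : ℕ, 1 ≤ k → 0 < γ k ^ 2) {d : ℕ} {ε : ℝ}
    (hε : 0 < ε) {F : Finset (Fin d → ℕ)}
    (hF : ∀ k, k ∈ F ↔ ε ^ 2 < ∏ j : Fin d, gaussianOmega (γ (j + 1)) ^ k j) :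
    gaussianInfo γ ε d = F.card := by
  have hω0 : ∀ j : Fin d, 0 ≤ gaussianOmega (γ (j + 1)) := fun j =>
    (gaussianOmega_pos (hpos _ (by omega))).le
  have hω1 : ∀ j : Fin d, gaussianOmega (γ (j + 1)) < 1 := fun j => gaussianOmega_lt_one _
  obtain ⟨e, he, horth, hlam⟩ := orthonormal_singularVectors (S := gaussianAPP γ d)
    (norm_gaussianEigenvector_pos γ) (fun _ _ => inner_gaussianEigenvector_of_ne γ)
    (gaussianEigenvalue_pos hpos) (gaussianAPP_adjoint_eigenvector γ)
  have h0 := gaussianEigenvalue_pos hpos (0 : Fin d → ℕ)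
  refine infoComplexityNOR_eq_card he horth hlam (fun δ hδ => ?_) 0 (fun k => ?_) hε fun k => ?_
  · have hlim : Tendsto (fun N : ℕ => ∏ j : Fin d, (1 - gaussianOmega (γ (j + 1)) ^ N)) atTop
        (𝓝 (∏ _j : Fin d, (1 - 0))) :=
      tendsto_finsetProd _ fun j _ =>
        tendsto_const_nhds.sub (tendsto_pow_atTop_nhds_zero_of_lt_one (hω0 j) (hω1 j))
    have hev := hlim.eventually (lt_mem_nhds (a := 1 - δ ^ 2) (by simp; positivity))
    obtain ⟨N, hN⟩ := hev.exists
    refine ⟨Fintype.piFinset fun _ => Finset.range N, fun E hE f hf => ?_⟩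
    have h1 := norm_gaussianAPP_sq_le γ he E hf
    have h2 : 1 - δ ^ 2 ≤ ∑ k ∈ E, ‖gaussianAPP γ d (e k)‖ ^ 2 := by
      refine le_trans ?_ (Finset.sum_le_sum_of_subset_of_nonneg hE fun _ _ _ => sq_nonneg _)
      simp only [hlam]
      rw [sum_gaussianEigenvalue]
      exact hN.le
    refine (abs_le_of_sq_le_sq' ?_ (by positivity)).2
    rw [mul_pow]
    refine h1.trans (mul_le_mul_of_nonneg_right (by linarith) (sq_nonneg _))
  · rw [gaussianEigenvalue_eq]
    exact mul_le_of_le_one_right h0.le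
      (Finset.prod_le_one (fun j _ => pow_nonneg (hω0 j) _)
        fun j _ => pow_le_one₀ (hω0 j) (hω1 j).le)
  · rw [hF, gaussianEigenvalue_eq γ k, mul_comm (ε ^ 2), mul_lt_mul_iff_right₀ h0]

theorem exists_gaussianInfo_eq_card {γ : ℕ → ℝ} (hpos : ∀ k : ℕ, 1 ≤ k → 0 < γ k ^ 2) (d : ℕ)
    {ε : ℝ} (hε : 0 < ε) :
    ∃ F : Finset (Fin d → ℕ),
      (∀ k, k ∈ F ↔ ε ^ 2 < ∏ j : Fin d, gaussianOmega (γ (j + 1)) ^ k j) ∧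
      gaussianInfo γ ε d = F.card := by
  classical
  have hω0 : ∀ j : Fin d, 0 ≤ gaussianOmega (γ (j + 1)) := fun j =>
    (gaussianOmega_pos (hpos _ (by omega))).le
  have hω1 : ∀ j : Fin d, gaussianOmega (γ (j + 1)) < 1 := fun j => gaussianOmega_lt_one _
  -- Once `k j ≥ N j`, the single factor `ω_j ^ k j` is already below `ε²`; hence only finitely many
  -- indices qualify.
  choose N hN using fun j => exists_pow_lt_of_lt_one (pow_pos hε 2) (hω1 j)
  have hmem : ∀ k, k ∈ (Fintype.piFinset fun j => Finset.range (N j)).filter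
      (fun k => ε ^ 2 < ∏ j : Fin d, gaussianOmega (γ (j + 1)) ^ k j) ↔
      ε ^ 2 < ∏ j : Fin d, gaussianOmega (γ (j + 1)) ^ k j := by
    intro k
    rw [Finset.mem_filter, and_iff_right_iff_imp, Fintype.mem_piFinset]
    intro hk j
    rw [Finset.mem_range]
    by_contra! hle
    have h1 : ∏ i : Fin d, gaussianOmega (γ (i + 1)) ^ k i ≤ gaussianOmega (γ (j + 1)) ^ k j := by
      rw [← Finset.mul_prod_erase _ _ (Finset.mem_univ j)]
      exact mul_le_of_le_one_right (pow_nonneg (hω0 j) _)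
        (Finset.prod_le_one (fun i _ => pow_nonneg (hω0 i) _)
          fun i _ => pow_le_one₀ (hω0 i) (hω1 i).le)
    have h2 := pow_le_pow_of_le_one (hω0 j) (hω1 j).le hle
    linarith [hN j]
  exact ⟨_, hmem, gaussianInfo_eq_card hpos hε hmem⟩

/-! ## Bounds for the information complexity -/

theorem gaussianOmega_inv {γ : ℝ} :
    (gaussianOmega γ)⁻¹ = (1 + 2 * γ ^ 2 + √(1 + 4 * γ ^ 2)) / (2 * γ ^ 2) := by
  rw [gaussianOmega, inv_div]

theorem gaussianOmega_le_of_sq_le {γ δ : ℝ} (h : γ ^ 2 ≤ δ ^ 2) :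
    gaussianOmega γ ≤ gaussianOmega δ := by
  have h0 := gaussianRate_nonneg γ
  have h1 : gaussianRate γ ≤ gaussianRate δ := by
    unfold gaussianRate
    have : √(1 + 4 * γ ^ 2) ≤ √(1 + 4 * δ ^ 2) := Real.sqrt_le_sqrt (by linarith)
    linarith
  rw [gaussianOmega_eq, gaussianOmega_eq, div_le_div_iff₀ (by linarith) (by linarith)]
  linarith

theorem gaussianOmega_le_gaussianOmega {γ : ℕ → ℝ}
    (hanti : ∀ k : ℕ, 1 ≤ k → γ (k + 1) ^ 2 ≤ γ k ^ 2)
    {j k : ℕ} (hj : 1 ≤ j) (hjk : j ≤ k) :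
    gaussianOmega (γ k) ≤ gaussianOmega (γ j) := by
  refine gaussianOmega_le_of_sq_le ?_
  induction k, hjk using Nat.le_induction with
  | base => exact le_rfl
  | succ k hk ih => exact (hanti k (hj.trans hk)).trans ih

/-- A Markov-type estimate: each counted `k` contributes at least `1` to `ε^(-2τ) ∏ ω_j^(τ k_j)`,
and the sum over all `k` factors into geometric series. -/
theorem gaussianInfo_le_prod {γ : ℕ → ℝ}
    (hpos : ∀ k : ℕ, 1 ≤ k → 0 < γ k ^ 2)
    (d : ℕ) {ε τ : ℝ} (hε : 0 < ε) (hτ : 0 < τ) :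
    (gaussianInfo γ ε d : ℝ≥0∞) ≤ ENNReal.ofReal
      (ε⁻¹ ^ (2 * τ) * ∏ j : Fin d, (1 - gaussianOmega (γ (j + 1)) ^ τ)⁻¹) := by
  obtain ⟨F, hF, hcard⟩ := exists_gaussianInfo_eq_card hpos d hε
  have hω0 : ∀ j : Fin d, 0 < gaussianOmega (γ (j + 1)) := fun j =>
    gaussianOmega_pos (hpos _ (by omega))
  have hω1 : ∀ j : Fin d, gaussianOmega (γ (j + 1)) < 1 := fun j => gaussianOmega_lt_one _
  rw [hcard, ENat.toENNReal_coe, ← ENNReal.ofReal_natCast]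
  refine ENNReal.ofReal_le_ofReal ?_
  obtain ⟨N, hN⟩ : ∃ N, F ⊆ Fintype.piFinset fun _ => Finset.range N := by
    refine ⟨F.sup (fun k => Finset.univ.sup k) + 1, fun k hk => ?_⟩
    rw [Fintype.mem_piFinset]
    intro j
    rw [Finset.mem_range, Nat.lt_succ_iff]
    exact (Finset.le_sup (f := k) (Finset.mem_univ j)).trans
      (Finset.le_sup (f := fun k : Fin d → ℕ => Finset.univ.sup k) hk)
  have hone : ∀ k ∈ F, (1 : ℝ) ≤
      ε⁻¹ ^ (2 * τ) * ∏ j : Fin d, (gaussianOmega (γ (j + 1)) ^ τ) ^ k j := by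
    intro k hk
    have h1 : (ε ^ 2) ^ τ ≤ (∏ j : Fin d, gaussianOmega (γ (j + 1)) ^ k j) ^ τ :=
      Real.rpow_le_rpow (by positivity) ((hF k).1 hk).le hτ.le
    have h2 : (∏ j : Fin d, gaussianOmega (γ (j + 1)) ^ k j) ^ τ =
        ∏ j : Fin d, (gaussianOmega (γ (j + 1)) ^ τ) ^ k j := by
      rw [← Real.finsetProd_rpow _ _ fun j _ => pow_nonneg (hω0 j).le _]
      refine Finset.prod_congr rfl fun j _ => ?_
      rw [← Real.rpow_natCast, ← Real.rpow_natCast, ← Real.rpow_mul (hω0 j).le,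
        ← Real.rpow_mul (hω0 j).le, mul_comm]
    have h3 : ε⁻¹ ^ (2 * τ) * (ε ^ 2) ^ τ = 1 := by
      rw [← Real.rpow_natCast ε 2, ← Real.rpow_mul hε.le, Real.inv_rpow hε.le]
      push_cast
      exact inv_mul_cancel₀ (by positivity)
    rw [← h2, ← h3]
    exact mul_le_mul_of_nonneg_left h1 (by positivity)
  calc (F.card : ℝ) = ∑ k ∈ F, (1 : ℝ) := by simp
    _ ≤ ∑ k ∈ F, ε⁻¹ ^ (2 * τ) * ∏ j : Fin d, (gaussianOmega (γ (j + 1)) ^ τ) ^ k j :=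
        Finset.sum_le_sum hone
    _ ≤ ∑ k ∈ Fintype.piFinset fun _ : Fin d => Finset.range N,
          ε⁻¹ ^ (2 * τ) * ∏ j : Fin d, (gaussianOmega (γ (j + 1)) ^ τ) ^ k j :=
        Finset.sum_le_sum_of_subset_of_nonneg hN fun k _ _ =>
          mul_nonneg (by positivity) (Finset.prod_nonneg fun j _ =>
            pow_nonneg (Real.rpow_nonneg (hω0 j).le _) _)
    _ = ε⁻¹ ^ (2 * τ) * ∏ j : Fin d, ∑ i ∈ Finset.range N,
          (gaussianOmega (γ (j + 1)) ^ τ) ^ i := by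
        rw [← Finset.mul_sum, ← Finset.prod_univ_sum (fun _ : Fin d => Finset.range N)
          fun j i => (gaussianOmega (γ (j + 1)) ^ τ) ^ i]
    _ ≤ _ := by
        refine mul_le_mul_of_nonneg_left (Finset.prod_le_prod (fun j _ =>
          Finset.sum_nonneg fun i _ => pow_nonneg (Real.rpow_nonneg (hω0 j).le _) _)
          fun j _ => ?_) (by positivity)
        have h4 := Real.rpow_lt_one (hω0 j).le (hω1 j) hτ
        have h5 := Real.rpow_nonneg (hω0 j).le τ
        rw [← tsum_geometric_of_lt_one h5 h4]
        exact (summable_geometric_of_lt_one h5 h4).sum_le_tsum _ fun i _ => pow_nonneg h5 i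

/-- Uses `(1 - x)⁻¹ = 1 + x / (1 - x) ≤ exp(x / (1 - x))` with `x = ω_j^τ ≤ ω_1^σ`. The separate `σ`
keeps the denominator independent of `d` when `τ` grows with `d`, as it does for QPT. -/
theorem gaussianInfo_le_exp {γ : ℕ → ℝ}
    (hpos : ∀ k : ℕ, 1 ≤ k → 0 < γ k ^ 2)
    (hanti : ∀ k : ℕ, 1 ≤ k → γ (k + 1) ^ 2 ≤ γ k ^ 2)
    (d : ℕ) {ε τ σ : ℝ} (hε : 0 < ε) (hσ : 0 < σ) (hτ : σ ≤ τ) :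
    (gaussianInfo γ ε d : ℝ≥0∞) ≤ ENNReal.ofReal
      (ε⁻¹ ^ (2 * τ) * Real.exp ((∑ j ∈ Finset.range d, gaussianOmega (γ (j + 1)) ^ τ) /
        (1 - gaussianOmega (γ 1) ^ σ))) := by
  refine (gaussianInfo_le_prod hpos d hε (hσ.trans_le hτ)).trans (ENNReal.ofReal_le_ofReal ?_)
  refine mul_le_mul_of_nonneg_left ?_ (by positivity)
  have hω0 : ∀ j : ℕ, 0 < gaussianOmega (γ (j + 1)) := fun j =>
    gaussianOmega_pos (hpos _ (by omega))
  have hq : gaussianOmega (γ 1) ^ σ < 1 :=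
    Real.rpow_lt_one (hω0 0).le (gaussianOmega_lt_one _) hσ
  rw [← Fin.sum_univ_eq_sum_range (fun j => gaussianOmega (γ (j + 1)) ^ τ), Finset.sum_div,
    Real.exp_sum]
  have hx : ∀ j : Fin d, gaussianOmega (γ (j + 1)) ^ τ ≤ gaussianOmega (γ 1) ^ σ := fun j =>
    (Real.rpow_le_rpow_of_exponent_ge (hω0 j) (gaussianOmega_lt_one _).le hτ).trans
      (Real.rpow_le_rpow (hω0 j).le
        (gaussianOmega_le_gaussianOmega hanti le_rfl (by omega)) hσ.le)
  refine Finset.prod_le_prod (fun j _ => inv_nonneg.2 (by linarith [hx j])) fun j _ => ?_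
  set x := gaussianOmega (γ (j + 1)) ^ τ
  have hx0 : 0 ≤ x := Real.rpow_nonneg (hω0 j).le _
  have h1 : 0 < 1 - x := by linarith [hx j]
  calc (1 - x)⁻¹ = x / (1 - x) + 1 := by field_simp; ring
    _ ≤ x / (1 - gaussianOmega (γ 1) ^ σ) + 1 := by
        have := hx j
        gcongr
    _ ≤ _ := Real.add_one_le_exp _

/-- Indicators of the `m`-subsets of the coordinates all qualify, since `ω_d` is the smallest
factor. -/
theorem choose_le_gaussianInfo {γ : ℕ → ℝ}
    (hpos : ∀ k : ℕ, 1 ≤ k → 0 < γ k ^ 2)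
    (hanti : ∀ k : ℕ, 1 ≤ k → γ (k + 1) ^ 2 ≤ γ k ^ 2)
    {d m : ℕ} {ε : ℝ} (hε : 0 < ε)
    (h : ε ^ 2 < gaussianOmega (γ d) ^ m) :
    ((d.choose m : ℕ) : ℕ∞) ≤ gaussianInfo γ ε d := by
  classical
  obtain ⟨F, hF, hcard⟩ := exists_gaussianInfo_eq_card hpos d hε
  rw [hcard, Nat.cast_le]
  have hc : d.choose m = (Finset.powersetCard m (Finset.univ : Finset (Fin d))).card := by
    simp
  rw [hc]
  refine Finset.card_le_card_of_injOn (fun s j => if j ∈ s then 1 else 0) (fun s hs => ?_)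
    fun s _ t _ hst => ?_
  · have hs' := (Finset.mem_powersetCard.1 hs).2
    rw [Finset.mem_coe, hF]
    refine h.trans_le ?_
    rw [← hs', ← Finset.prod_const]
    simp only [pow_ite, pow_one, pow_zero, Finset.prod_ite_mem, Finset.univ_inter]
    refine Finset.prod_le_prod (fun j _ => ?_) fun j _ => ?_
    · exact (gaussianOmega_pos (hpos _ (by have := j.2; omega))).le
    · exact gaussianOmega_le_gaussianOmega hanti (by omega) (by have := j.2; omega)
  · ext j
    have := congrFun hst j
    by_cases h1 : j ∈ s <;> by_cases h2 : j ∈ t <;> simp_all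

theorem one_le_gaussianInfo {γ : ℕ → ℝ}
    (hpos : ∀ k : ℕ, 1 ≤ k → 0 < γ k ^ 2)
    (hanti : ∀ k : ℕ, 1 ≤ k → γ (k + 1) ^ 2 ≤ γ k ^ 2)
    {d : ℕ} {ε : ℝ} (hε : 0 < ε) (hε1 : ε < 1) :
    1 ≤ gaussianInfo γ ε d := by
  have := choose_le_gaussianInfo hpos hanti (d := d) (m := 0) hε
    (by rw [pow_zero]; exact pow_lt_one₀ hε.le hε1 two_ne_zero)
  simpa using this

/-- The lower bound in real form: `d^m` is dominated by any upper bound for the complexity. -/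
theorem pow_le_of_gaussianInfo_le {γ : ℕ → ℝ}
    (hpos : ∀ k : ℕ, 1 ≤ k → 0 < γ k ^ 2)
    (hanti : ∀ k : ℕ, 1 ≤ k → γ (k + 1) ^ 2 ≤ γ k ^ 2)
    {d m : ℕ} (hdm : 2 * m ≤ d) {ε b : ℝ} (hε : 0 < ε)
    (h : ε ^ 2 < gaussianOmega (γ d) ^ m)
    (hb : (gaussianInfo γ ε d : ℝ≥0∞) ≤ ENNReal.ofReal b) :
    (d : ℝ) ^ m ≤ 2 ^ m * m.factorial * b := by
  have h1 : ((d.choose m : ℕ) : ℝ≥0∞) ≤ ENNReal.ofReal b := by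
    refine le_trans ?_ hb
    have := choose_le_gaussianInfo hpos hanti hε h
    exact_mod_cast ENat.toENNReal_le.2 this
  have hch : 0 < d.choose m := Nat.choose_pos (by omega)
  have hb0 : 0 < b := by
    by_contra! hneg
    rw [ENNReal.ofReal_of_nonpos hneg, nonpos_iff_eq_zero, Nat.cast_eq_zero] at h1
    omega
  rw [← ENNReal.ofReal_natCast, ENNReal.ofReal_le_ofReal_iff hb0.le] at h1
  -- `d.choose m ≥ (d + 1 - m)^m / m! ≥ (d/2)^m / m!`, the last step by `2 m ≤ d`.
  have h2 : (((d + 1 - m : ℕ) : ℝ)) ^ m ≤ (m.factorial : ℝ) * (d.choose m : ℝ) := by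
    rw [← div_le_iff₀' (by positivity)]
    exact Nat.pow_le_choose m d
  have h3 : (d : ℝ) / 2 ≤ ((d + 1 - m : ℕ) : ℝ) := by
    rw [div_le_iff₀ two_pos]
    exact_mod_cast (by omega : d ≤ (d + 1 - m) * 2)
  have h4 := pow_le_pow_left₀ (by positivity) h3 m
  rw [div_pow, div_le_iff₀ (by positivity)] at h4
  calc (d : ℝ) ^ m ≤ ((d + 1 - m : ℕ) : ℝ) ^ m * 2 ^ m := h4
    _ ≤ (m.factorial * b) * 2 ^ m := by
        gcongr
        exact h2.trans (mul_le_mul_of_nonneg_left h1 (by positivity))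
    _ = _ := by ring

/-! ## Exponents of tractability -/

/-- The boundary case `2 / p = r` may go either way without changing the infimum, so a strict
sufficient and a weak necessary condition are enough. -/
theorem iInf_eq_two_div {Q : ℝ → Prop} {r : EReal} (hr : 0 < r)
    (hle : ∀ p, Q p → 0 < p ∧ ((2 / p : ℝ) : EReal) ≤ r)
    (hlt : ∀ p, 0 < p → ((2 / p : ℝ) : EReal) < r → Q p) :
    ⨅ (p : ℝ) (_ : Q p), (p : EReal) = 2 / r := by
  induction r with
  | bot => exact absurd hr (by simp)
  | top =>
    rw [EReal.div_top]
    refine le_antisymm ?_ (le_iInf₂ fun p hp => EReal.coe_nonneg.2 (hle p hp).1.le)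
    rw [← EReal.le_of_forall_lt_iff_le]
    intro p hp
    exact iInf₂_le p (hlt p (EReal.coe_pos.1 hp) (EReal.coe_lt_top _))
  | coe ρ =>
    have hρ : 0 < ρ := EReal.coe_pos.1 hr
    have h2 : (2 : EReal) / (ρ : EReal) = ((2 / ρ : ℝ) : EReal) := by
      rw [EReal.coe_div]
      rfl
    rw [h2]
    refine le_antisymm ?_ (le_iInf₂ fun p hp => ?_)
    · rw [← EReal.le_of_forall_lt_iff_le]
      intro p hp
      rw [EReal.coe_lt_coe_iff] at hp
      have hp0 : 0 < p := lt_trans (by positivity) hp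
      refine iInf₂_le p (hlt p hp0 ?_)
      rw [EReal.coe_lt_coe_iff, div_lt_iff₀ hp0]
      rw [div_lt_iff₀ hρ] at hp
      linarith
    · obtain ⟨hp0, h⟩ := hle p hp
      rw [EReal.coe_le_coe_iff, div_le_iff₀ hp0] at h
      rw [EReal.coe_le_coe_iff, div_le_iff₀ hρ]
      linarith

theorem liminf_coe_le_of_tendsto_sub {u v : ℕ → ℝ} (h : Tendsto (fun k => u k - v k) atTop (𝓝 0)) :
    liminf (fun k => (v k : EReal)) atTop ≤ liminf (fun k => (u k : EReal)) atTop := by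
  have h0 : liminf (fun k => ((u k - v k : ℝ) : EReal)) atTop = 0 :=
    ((continuous_coe_real_ereal.tendsto 0).comp h).liminf_eq
  have h1 := EReal.le_liminf_add (u := fun k => (v k : EReal))
    (v := fun k => ((u k - v k : ℝ) : EReal)) (f := atTop)
  rw [h0, add_zero] at h1
  refine h1.trans_eq ?_
  congr 1
  ext k
  rw [Pi.add_apply, ← EReal.coe_add]
  congr 1
  ring

theorem liminf_coe_eq_of_tendsto_sub {u v : ℕ → ℝ} (h : Tendsto (fun k => u k - v k) atTop (𝓝 0)) :
    liminf (fun k => (u k : EReal)) atTop = liminf (fun k => (v k : EReal)) atTop := by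
  refine le_antisymm (liminf_coe_le_of_tendsto_sub ?_) (liminf_coe_le_of_tendsto_sub h)
  simpa using h.neg

theorem tendsto_log_natCast_atTop : Tendsto (fun k : ℕ => Real.log k) atTop atTop :=
  Real.tendsto_log_atTop.comp tendsto_natCast_atTop_atTop

theorem nonpos_of_eventually_mul_le {u : ℕ → ℝ} (hu : Tendsto u atTop atTop) {c K : ℝ}
    (h : ∀ᶠ k in atTop, c * u k ≤ K) : c ≤ 0 := by
  by_contra! hc
  obtain ⟨k, h1, h2⟩ := (h.and ((hu.const_mul_atTop hc).eventually_gt_atTop K)).exists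
  linarith

/-! ### Strong polynomial and polynomial tractability. -/

theorem liminf_log_gaussianOmega_inv {γ : ℕ → ℝ} (hpos : ∀ k : ℕ, 1 ≤ k → 0 < γ k ^ 2)
    (hanti : ∀ k : ℕ, 1 ≤ k → γ (k + 1) ^ 2 ≤ γ k ^ 2) :
    liminf (fun k : ℕ => ((Real.log (gaussianOmega (γ k))⁻¹ / Real.log k : ℝ) : EReal)) atTop
      = shapeDecay γ := by
  refine liminf_coe_eq_of_tendsto_sub ?_
  -- `ω_k⁻¹ = γ_k⁻² s k` with `1 ≤ s k ≤ s 1`, so the two quotients differ by a bounded quantity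
  -- over `ln k`.
  set s : ℕ → ℝ := fun k => (1 + 2 * γ k ^ 2 + √(1 + 4 * γ k ^ 2)) / 2 with hs
  have hle : ∀ k, 1 ≤ k → γ k ^ 2 ≤ γ 1 ^ 2 := by
    intro k hk
    induction k, hk using Nat.le_induction with
    | base => exact le_rfl
    | succ k hk ih => exact (hanti k hk).trans ih
  have hs1 : ∀ k, 1 ≤ s k := fun k => by
    have : 1 ≤ √(1 + 4 * γ k ^ 2) := Real.one_le_sqrt.2 (by nlinarith [sq_nonneg (γ k)])
    simp only [hs]
    nlinarith [sq_nonneg (γ k)]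
  have hs2 : ∀ k, 1 ≤ k → s k ≤ s 1 := fun k hk => by
    have h1 := hle k hk
    have : √(1 + 4 * γ k ^ 2) ≤ √(1 + 4 * γ 1 ^ 2) := Real.sqrt_le_sqrt (by linarith)
    simp only [hs]
    linarith
  have hev : ∀ᶠ k : ℕ in atTop, Real.log (s k) / Real.log k =
      Real.log (gaussianOmega (γ k))⁻¹ / Real.log k -
        Real.log (γ k ^ 2)⁻¹ / Real.log k := by
    filter_upwards [eventually_ge_atTop 1] with k hk
    have h1 : (gaussianOmega (γ k))⁻¹ = (γ k ^ 2)⁻¹ * s k := by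
      rw [gaussianOmega_inv]
      have := (hpos k hk).ne'
      simp only [hs]
      field_simp
    rw [h1, Real.log_mul (inv_ne_zero (hpos k hk).ne') (by linarith [hs1 k])]
    ring
  refine Tendsto.congr' hev ?_
  refine squeeze_zero' (Eventually.of_forall fun k => ?_) ?_
    (tendsto_const_nhds.div_atTop tendsto_log_natCast_atTop (a := Real.log (s 1)))
  · exact div_nonneg (Real.log_nonneg (hs1 k)) (Real.log_natCast_nonneg k)
  · filter_upwards [eventually_ge_atTop 1] with k hk
    exact div_le_div_of_nonneg_right (Real.log_le_log (by linarith [hs1 k]) (hs2 k hk))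
      (Real.log_natCast_nonneg k)

/-- With `ε²` just below `ω_d ^ m`, the lower bound gives `d ^ m ≲ d ^ q ω_d^(-pm/2)`; take
logarithms and divide by `ln d`. The free `m` serves both SPT (`m = 1`, `q = 0`, sharp) and PT (any
`m > q`). -/
theorem shapeDecay_ge_of_polynomial_bound {γ : ℕ → ℝ} (hpos : ∀ k : ℕ, 1 ≤ k → 0 < γ k ^ 2)
    (hanti : ∀ k : ℕ, 1 ≤ k → γ (k + 1) ^ 2 ≤ γ k ^ 2) {C p q : ℝ} (hC : 0 ≤ C) (hp : 0 ≤ p)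
    (hn : ∀ d : ℕ, 1 ≤ d → ∀ ε : ℝ, 0 < ε → ε < 1 →
      (gaussianInfo γ ε d : ℝ≥0∞) ≤ ENNReal.ofReal (C * (d : ℝ) ^ q * ε⁻¹ ^ p))
    {m : ℕ} (hm : 1 ≤ m) (hqm : q < m) :
    0 < p ∧ ((2 * (m - q) / (m * p) : ℝ) : EReal) ≤ shapeDecay γ := by
  set K := Real.log (2 ^ m * m.factorial * (C + 1)) + p / 2 * Real.log 2 with hK
  have hm0 : (0 : ℝ) < m := by exact_mod_cast hm
  have key : ∀ᶠ d : ℕ in atTop, (m - q) * Real.log d ≤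
      K + p * m / 2 * Real.log (gaussianOmega (γ d))⁻¹ := by
    filter_upwards [eventually_ge_atTop (2 * m)] with d hd
    have hd1 : 1 ≤ d := by omega
    have hd0 : (0 : ℝ) < d := by exact_mod_cast hd1
    have hw0 := gaussianOmega_pos (hpos d hd1)
    have hw1 := gaussianOmega_lt_one (γ d)
    set w := gaussianOmega (γ d)
    -- Halving makes `ε² < w ^ m` strict and keeps `ε < 1`.
    have hε2 : √(w ^ m / 2) ^ 2 = w ^ m / 2 := Real.sq_sqrt (by positivity)
    have hwm : w ^ m ≤ 1 := pow_le_one₀ hw0.le hw1.le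
    have hε0 : 0 < √(w ^ m / 2) := Real.sqrt_pos.2 (by positivity)
    have hε1 : √(w ^ m / 2) < 1 := by
      rw [Real.sqrt_lt' one_pos]
      linarith
    have h1 := pow_le_of_gaussianInfo_le hpos hanti hd hε0
      (by rw [hε2]; exact half_lt_self (by positivity)) (hn d hd1 _ hε0 hε1)
    -- `C + 1` replaces `C`, which may vanish, so that logarithms can be taken.
    have h2 : (d : ℝ) ^ m ≤ (2 ^ m * m.factorial * (C + 1)) *
        ((d : ℝ) ^ q * (√(w ^ m / 2))⁻¹ ^ p) := by
      refine h1.trans ?_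
      rw [mul_assoc (2 ^ m * (m.factorial : ℝ)), mul_assoc C]
      gcongr
      linarith
    have h3 := Real.log_le_log (by positivity) h2
    rw [Real.log_mul (x := 2 ^ m * m.factorial * (C + 1)) (by positivity) (by positivity),
      Real.log_mul (x := (d : ℝ) ^ q) (by positivity) (by positivity),
      Real.log_pow, Real.log_rpow hd0, Real.log_rpow (by positivity), Real.log_inv,
      Real.log_sqrt (by positivity), Real.log_div (by positivity) two_ne_zero, Real.log_pow] at h3
    rw [hK, Real.log_inv]
    linarith
  have hp0 : 0 < p := by
    refine hp.lt_of_ne fun h0 => ?_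
    subst h0
    have := nonpos_of_eventually_mul_le tendsto_log_natCast_atTop (c := m - q) (K := K)
      (key.mono fun d hd => by simpa using hd)
    linarith
  refine ⟨hp0, ?_⟩
  rw [← liminf_log_gaussianOmega_inv hpos hanti]
  have hlim : Tendsto (fun d : ℕ => 2 / (m * p) * ((m - q) - K / Real.log d)) atTop
      (𝓝 (2 / (m * p) * ((m - q) - 0))) :=
    (tendsto_const_nhds.sub
      (tendsto_const_nhds.div_atTop tendsto_log_natCast_atTop)).const_mul _
  have hval : 2 / (m * p) * ((m - q) - 0) = 2 * (m - q) / (m * p) := by ring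
  rw [hval] at hlim
  rw [← ((continuous_coe_real_ereal.tendsto _).comp hlim).liminf_eq]
  refine liminf_le_liminf ?_
  filter_upwards [key, tendsto_log_natCast_atTop.eventually_gt_atTop 0] with d hd hlog
  simp only [Function.comp_apply]
  rw [EReal.coe_le_coe_iff, le_div_iff₀ hlog]
  have : 2 / (m * p) * ((m - q) - K / Real.log d) * Real.log d =
      2 / (m * p) * ((m - q) * Real.log d - K) := by field_simp
  rw [this, div_mul_eq_mul_div, div_le_iff₀ (by positivity)]
  linarith

theorem two_div_le_shapeDecay_of_sptBound {γ : ℕ → ℝ} (hpos : ∀ k : ℕ, 1 ≤ k → 0 < γ k ^ 2)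
    (hanti : ∀ k : ℕ, 1 ≤ k → γ (k + 1) ^ 2 ≤ γ k ^ 2) {p : ℝ}
    (h : SPTBound (gaussianInfo γ) p) : 0 < p ∧ ((2 / p : ℝ) : EReal) ≤ shapeDecay γ := by
  obtain ⟨hp, C, hC, hn⟩ := h
  have := shapeDecay_ge_of_polynomial_bound hpos hanti hC hp (q := 0) (m := 1)
    (fun d hd ε h0 h1 => by simpa using hn d hd ε h0 h1) le_rfl (by norm_num)
  simpa using this

theorem shapeDecay_pos_of_isPT {γ : ℕ → ℝ} (hpos : ∀ k : ℕ, 1 ≤ k → 0 < γ k ^ 2)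
    (hanti : ∀ k : ℕ, 1 ≤ k → γ (k + 1) ^ 2 ≤ γ k ^ 2) (h : IsPT (gaussianInfo γ)) :
    0 < shapeDecay γ := by
  obtain ⟨C, p, q, hC, hp, -, hn⟩ := h
  obtain ⟨m, hm⟩ := exists_nat_gt (max q 1)
  have hm1 : (1 : ℝ) < m := (le_max_right _ _).trans_lt hm
  have hmq : q < m := (le_max_left _ _).trans_lt hm
  obtain ⟨hp0, hle⟩ := shapeDecay_ge_of_polynomial_bound hpos hanti hC hp hn
    (m := m) (by exact_mod_cast hm1.le) hmq
  refine lt_of_lt_of_le (EReal.coe_pos.2 ?_) hle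
  have : 0 < (m : ℝ) - q := sub_pos.2 hmq
  positivity

/-- For `2 / p < s < r` eventually `ω_k ≤ k^(-s)`, and `s p / 2 > 1` makes `∑ ω_k^(p/2)` converge;
then `gaussianInfo_le_exp` applies with `τ = σ = p/2`. -/
theorem sptBound_of_two_div_lt_shapeDecay {γ : ℕ → ℝ} (hpos : ∀ k : ℕ, 1 ≤ k → 0 < γ k ^ 2)
    (hanti : ∀ k : ℕ, 1 ≤ k → γ (k + 1) ^ 2 ≤ γ k ^ 2) {p : ℝ} (hp : 0 < p)
    (h : ((2 / p : ℝ) : EReal) < shapeDecay γ) : SPTBound (gaussianInfo γ) p := by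
  rw [← liminf_log_gaussianOmega_inv hpos hanti] at h
  obtain ⟨s, hs1, hs2⟩ := EReal.lt_iff_exists_real_btwn.1 h
  rw [EReal.coe_lt_coe_iff] at hs1
  have hev := eventually_lt_of_lt_liminf hs2
  have hsum : Summable fun k : ℕ => gaussianOmega (γ k) ^ (p / 2) := by
    have h1 : 1 < s * (p / 2) := by
      rw [div_lt_iff₀ hp] at hs1
      linarith
    refine Summable.of_norm_bounded_eventually_nat
      (g := fun k : ℕ => (k : ℝ) ^ (-(s * (p / 2))))
      (Real.summable_nat_rpow.2 (by linarith)) ?_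
    filter_upwards [hev, tendsto_log_natCast_atTop.eventually_gt_atTop 0,
      eventually_ge_atTop 1] with k hk hlog hk1
    rw [EReal.coe_lt_coe_iff, lt_div_iff₀ hlog, Real.log_inv] at hk
    have hw := gaussianOmega_pos (hpos k hk1)
    have hk0 : (0 : ℝ) < k := by exact_mod_cast hk1
    rw [Real.norm_of_nonneg (by positivity), Real.rpow_def_of_pos hw, Real.rpow_def_of_pos hk0]
    refine Real.exp_le_exp.2 ?_
    nlinarith
  have hsum' : Summable fun k : ℕ => gaussianOmega (γ (k + 1)) ^ (p / 2) :=
    (summable_nat_add_iff 1).2 hsum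
  set M := Real.exp ((∑' k : ℕ, gaussianOmega (γ (k + 1)) ^ (p / 2)) /
    (1 - gaussianOmega (γ 1) ^ (p / 2))) with hM
  refine ⟨hp.le, M, (Real.exp_pos _).le, fun d hd ε h0 h1 => ?_⟩
  refine (gaussianInfo_le_exp hpos hanti d h0 (half_pos hp) le_rfl).trans
    (ENNReal.ofReal_le_ofReal ?_)
  have hq : gaussianOmega (γ 1) ^ (p / 2) < 1 :=
    Real.rpow_lt_one (gaussianOmega_pos (hpos 1 le_rfl)).le (gaussianOmega_lt_one _) (half_pos hp)
  rw [mul_div_cancel₀ p two_ne_zero, mul_comm M]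
  refine mul_le_mul_of_nonneg_left (Real.exp_le_exp.2 ?_) (by positivity)
  refine div_le_div_of_nonneg_right (hsum'.sum_le_tsum _ fun k _ => ?_) (by linarith)
  exact Real.rpow_nonneg (gaussianOmega_pos (hpos _ (by omega))).le _

theorem isSPT_gaussianInfo_iff {γ : ℕ → ℝ} (hpos : ∀ k : ℕ, 1 ≤ k → 0 < γ k ^ 2)
    (hanti : ∀ k : ℕ, 1 ≤ k → γ (k + 1) ^ 2 ≤ γ k ^ 2) :
    IsSPT (gaussianInfo γ) ↔ 0 < shapeDecay γ := by
  constructor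
  · rintro ⟨p, hp⟩
    obtain ⟨hp0, hle⟩ := two_div_le_shapeDecay_of_sptBound hpos hanti hp
    exact lt_of_lt_of_le (EReal.coe_pos.2 (by positivity)) hle
  · intro h
    obtain ⟨s, hs1, hs2⟩ := EReal.lt_iff_exists_real_btwn.1 h
    have hs0 : 0 < s := EReal.coe_pos.1 hs1
    refine ⟨2 / s, sptBound_of_two_div_lt_shapeDecay hpos hanti (by positivity) ?_⟩
    rwa [div_div_cancel₀ two_ne_zero]

theorem IsSPT.isPT {n : ℝ → ℕ → ℕ∞} (h : IsSPT n) : IsPT n := by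
  obtain ⟨p, hp, C, hC, hn⟩ := h
  exact ⟨C, p, 0, hC, hp, le_rfl, fun d hd ε h0 h1 => by simpa using hn d hd ε h0 h1⟩

/-! ## Quasi-polynomial tractability -/

/-- Since `ω_d ≥ e^(-b)` for all `d ≥ 1`, one `ε = e^(-l)` with `l ≈ b m / 2` works for all `d ≥
2m`. Letting `d → ∞` gives `m ≤ t (1 + l)`, and then `m → ∞` gives `1 ≤ t b / 2`. -/
theorem two_div_le_of_qptBound {γ : ℕ → ℝ} (hpos : ∀ k : ℕ, 1 ≤ k → 0 < γ k ^ 2)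
    (hanti : ∀ k : ℕ, 1 ≤ k → γ (k + 1) ^ 2 ≤ γ k ^ 2) {t b : ℝ}
    (h : QPTBound (gaussianInfo γ) t)
    (hb : ∀ k : ℕ, 1 ≤ k → Real.log (gaussianOmega (γ k))⁻¹ ≤ b) : 2 / t ≤ b := by
  obtain ⟨ht, C, hC, hn⟩ := h
  have hlog2 := Real.log_pos one_lt_two
  have hb0 : 0 ≤ b := le_trans (Real.log_nonneg ((one_le_inv₀
    (gaussianOmega_pos (hpos 1 le_rfl))).2 (gaussianOmega_lt_one _).le)) (hb 1 le_rfl)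
  have key : ∀ m : ℕ, (m : ℝ) - t * (1 + (b * m + Real.log 2) / 2) ≤ 0 := by
    intro m
    -- The `log 2` makes `ε² < ω_d ^ m` strict and `l` positive even when `m = 0`.
    set l := (b * m + Real.log 2) / 2 with hl
    have hl0 : 0 < l := by positivity
    refine nonpos_of_eventually_mul_le tendsto_log_natCast_atTop
      (K := Real.log (2 ^ m * m.factorial * C) + t * (1 + l)) ?_
    filter_upwards [eventually_ge_atTop (2 * m), eventually_ge_atTop 1] with d hd hd1
    have hd0 : (0 : ℝ) < d := by exact_mod_cast hd1
    have hw0 := gaussianOmega_pos (hpos d hd1)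
    have hε : Real.exp (-l) ^ 2 < gaussianOmega (γ d) ^ m := by
      have h1 : Real.exp (-b) ≤ gaussianOmega (γ d) := by
        have := hb d hd1
        rw [Real.log_inv] at this
        rw [← Real.le_log_iff_exp_le hw0]
        linarith
      refine lt_of_lt_of_le ?_ (pow_le_pow_left₀ (Real.exp_pos _).le h1 m)
      rw [← Real.exp_nat_mul, ← Real.exp_nat_mul, Real.exp_lt_exp, hl]
      push_cast
      linarith
    have h1 := pow_le_of_gaussianInfo_le hpos hanti hd (Real.exp_pos _) hε
      (hn d hd1 _ (Real.exp_pos _) (by rw [Real.exp_lt_one_iff]; linarith))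
    rw [← Real.exp_neg, neg_neg, Real.log_exp, ← mul_assoc] at h1
    have h2 := Real.log_le_log (by positivity) h1
    rw [Real.log_pow, Real.log_mul (by positivity) (Real.exp_pos _).ne', Real.log_exp] at h2
    linarith
  have h2 : 1 - t * b / 2 ≤ 0 := by
    refine nonpos_of_eventually_mul_le (u := fun m : ℕ => (m : ℝ)) tendsto_natCast_atTop_atTop
      (K := t * (1 + Real.log 2 / 2)) (Eventually.of_forall fun m => ?_)
    have := key m
    linarith
  rw [div_le_iff₀ ht]
  linarith

theorem qptBound_of_eventually_lt {γ : ℕ → ℝ} (hpos : ∀ k : ℕ, 1 ≤ k → 0 < γ k ^ 2)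
    (hanti : ∀ k : ℕ, 1 ≤ k → γ (k + 1) ^ 2 ≤ γ k ^ 2) {t : ℝ} (ht : 0 < t)
    (h : ∀ᶠ k : ℕ in atTop, 2 / t < Real.log (gaussianOmega (γ k))⁻¹) :
    QPTBound (gaussianInfo γ) t := by
  obtain ⟨J, hJ⟩ := eventually_atTop.1 h
  set M := Real.exp ((J + 1) / (1 - gaussianOmega (γ 1) ^ (t / 2))) with hM
  refine ⟨ht, M, Real.exp_pos _, fun d hd ε h0 h1 => ?_⟩
  have hd0 : (0 : ℝ) < d := by exact_mod_cast hd
  have hlogd := Real.log_natCast_nonneg d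
  have hlogε : 0 < Real.log ε⁻¹ := Real.log_pos ((one_lt_inv₀ h0).2 h1)
  -- With this `τ`, `ε^(-2τ)` is `exp(t (1 + ln d) ln ε⁻¹)`, and `ω_j^τ ≤ 1/d` whenever `ln ω_j⁻¹ >
  -- 2/t`. The sum is thus at most `J + 1`, uniformly in `d`.
  set τ := t / 2 * (1 + Real.log d) with hτ
  have hτσ : t / 2 ≤ τ := by rw [hτ]; nlinarith
  have hτ0 : 0 < τ := by positivity
  refine (gaussianInfo_le_exp hpos hanti d h0 (half_pos ht) hτσ).trans
    (ENNReal.ofReal_le_ofReal ?_)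
  have hq : gaussianOmega (γ 1) ^ (t / 2) < 1 :=
    Real.rpow_lt_one (gaussianOmega_pos (hpos 1 le_rfl)).le (gaussianOmega_lt_one _) (half_pos ht)
  have hterm : ∀ j ∈ Finset.range d, gaussianOmega (γ (j + 1)) ^ τ ≤
      (if j < J then 1 else 0) + (d : ℝ)⁻¹ := by
    intro j _
    have hw0 := gaussianOmega_pos (hpos (j + 1) (by omega))
    split_ifs with hj
    · have := Real.rpow_le_one hw0.le (gaussianOmega_lt_one _).le hτ0.le
      have : (0 : ℝ) ≤ (d : ℝ)⁻¹ := by positivity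
      linarith
    · have h2 := hJ (j + 1) (by omega)
      rw [Real.log_inv, div_lt_iff₀ ht] at h2
      rw [zero_add, Real.rpow_def_of_pos hw0, ← Real.exp_log (inv_pos.2 hd0), Real.log_inv,
        Real.exp_le_exp, hτ]
      nlinarith
  have hsum : ∑ j ∈ Finset.range d, gaussianOmega (γ (j + 1)) ^ τ ≤ J + 1 := by
    refine (Finset.sum_le_sum hterm).trans ?_
    rw [Finset.sum_add_distrib, Finset.sum_const, Finset.card_range, nsmul_eq_mul,
      mul_inv_cancel₀ hd0.ne', Finset.sum_boole]
    have : (Finset.filter (fun j => j < J) (Finset.range d)).card ≤ (Finset.range J).card :=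
      Finset.card_le_card fun j hj => Finset.mem_range.2 (Finset.mem_filter.1 hj).2
    rw [Finset.card_range] at this
    have : ((Finset.filter (fun j => j < J) (Finset.range d)).card : ℝ) ≤ J := by
      exact_mod_cast this
    linarith
  rw [mul_comm M]
  refine mul_le_mul ?_ (Real.exp_le_exp.2
    (div_le_div_of_nonneg_right hsum (by linarith))) (Real.exp_pos _).le (Real.exp_pos _).le
  rw [Real.rpow_def_of_pos (inv_pos.2 h0), Real.exp_le_exp, hτ]
  nlinarith [mul_nonneg ht.le hlogd]

/-- The sequence increases from index `1` on (`γ 0` is unconstrained, hence the shift), so its limit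
is its supremum; that each term is at most `B` is what the lower bound for the QPT exponent needs.
-/
theorem exists_tendsto_log_gaussianOmega_inv {γ : ℕ → ℝ} (hpos : ∀ k : ℕ, 1 ≤ k → 0 < γ k ^ 2)
    (hanti : ∀ k : ℕ, 1 ≤ k → γ (k + 1) ^ 2 ≤ γ k ^ 2) :
    ∃ B : EReal, 0 < B ∧
      Tendsto (fun k : ℕ => ((Real.log (gaussianOmega (γ k))⁻¹ : ℝ) : EReal)) atTop (𝓝 B) ∧
      ∀ k : ℕ, 1 ≤ k → ((Real.log (gaussianOmega (γ k))⁻¹ : ℝ) : EReal) ≤ B := by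
  have hmono : Monotone fun k : ℕ =>
      ((Real.log (gaussianOmega (γ (k + 1)))⁻¹ : ℝ) : EReal) := by
    intro j k hjk
    have h1 := gaussianOmega_pos (hpos (k + 1) (by omega))
    have h2 := gaussianOmega_pos (hpos (j + 1) (by omega))
    exact EReal.coe_le_coe_iff.2 (Real.log_le_log (inv_pos.2 h2) (inv_anti₀ h1
      (gaussianOmega_le_gaussianOmega hanti (by omega) (by omega))))
  have hlim := tendsto_atTop_iSup hmono
  have hle : ∀ k : ℕ, 1 ≤ k → ((Real.log (gaussianOmega (γ k))⁻¹ : ℝ) : EReal) ≤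
      ⨆ k : ℕ, ((Real.log (gaussianOmega (γ (k + 1)))⁻¹ : ℝ) : EReal) := by
    intro k hk
    obtain ⟨j, rfl⟩ : ∃ j, k = j + 1 := ⟨k - 1, by omega⟩
    exact le_iSup (fun k : ℕ => ((Real.log (gaussianOmega (γ (k + 1)))⁻¹ : ℝ) : EReal)) j
  refine ⟨_, lt_of_lt_of_le (EReal.coe_pos.2 ?_) (hle 1 le_rfl), ?_, hle⟩
  · exact Real.log_pos ((one_lt_inv₀ (gaussianOmega_pos (hpos 1 le_rfl))).2
      (gaussianOmega_lt_one _))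
  · exact (tendsto_add_atTop_iff_nat 1).1 hlim

theorem isQPT_gaussianInfo {γ : ℕ → ℝ} (hpos : ∀ k : ℕ, 1 ≤ k → 0 < γ k ^ 2)
    (hanti : ∀ k : ℕ, 1 ≤ k → γ (k + 1) ^ 2 ≤ γ k ^ 2) : IsQPT (gaussianInfo γ) := by
  obtain ⟨B, hB0, hB, -⟩ := exists_tendsto_log_gaussianOmega_inv hpos hanti
  obtain ⟨s, hs1, hs2⟩ := EReal.lt_iff_exists_real_btwn.1 hB0
  have hs0 : 0 < s := EReal.coe_pos.1 hs1
  refine ⟨2 / s, qptBound_of_eventually_lt hpos hanti (by positivity) ?_⟩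
  rw [div_div_cancel₀ two_ne_zero]
  exact (hB.eventually (lt_mem_nhds hs2)).mono fun k hk => EReal.coe_lt_coe_iff.1 hk

theorem qptExponent_gaussianInfo {γ : ℕ → ℝ} (hpos : ∀ k : ℕ, 1 ≤ k → 0 < γ k ^ 2)
    (hanti : ∀ k : ℕ, 1 ≤ k → γ (k + 1) ^ 2 ≤ γ k ^ 2) {B : EReal} (hB0 : 0 < B)
    (hB : Tendsto (fun k : ℕ => ((Real.log (gaussianOmega (γ k))⁻¹ : ℝ) : EReal)) atTop (𝓝 B))
    (hle : ∀ k : ℕ, 1 ≤ k → ((Real.log (gaussianOmega (γ k))⁻¹ : ℝ) : EReal) ≤ B) :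
    qptExponent (gaussianInfo γ) = 2 / B := by
  refine iInf_eq_two_div hB0 (fun t ht => ⟨ht.1, ?_⟩) fun t ht0 ht => ?_
  · induction B with
    | bot => exact absurd hB0 (by simp)
    | top => exact le_top
    | coe b =>
      exact EReal.coe_le_coe_iff.2 (two_div_le_of_qptBound hpos hanti ht
        fun k hk => EReal.coe_le_coe_iff.1 (hle k hk))
  · exact qptBound_of_eventually_lt hpos hanti ht0
      ((hB.eventually (lt_mem_nhds ht)).mono fun k hk => EReal.coe_lt_coe_iff.1 hk)

/-! ## Weak tractability -/

/-- `1 + ln x` is dominated by every positive power of `x ≥ 1`. -/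
theorem one_add_log_le_rpow {a x : ℝ} (ha : 0 < a) (hx : 1 ≤ x) :
    1 + Real.log x ≤ (1 + a⁻¹) * x ^ a := by
  have h1 := Real.log_le_rpow_div (zero_le_one.trans hx) ha
  have h2 := Real.one_le_rpow hx ha.le
  rw [div_eq_inv_mul] at h1
  linarith

/-- Each of `1 + ln d` and `1 + ln ε⁻¹` is at most a constant times `D^(1/4)`, where `D = ε⁻ˢ + dᵗ`,
so their product is `O(D^(1/2)) = o(D)`. The hypothesis `hone` keeps the logarithm nonnegative,
excluding `log 0 = ⊥`. -/
theorem IsQPT.isSTWT {n : ℝ → ℕ → ℕ∞} (h : IsQPT n)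
    (hone : ∀ ε d, 0 < ε → ε < 1 → 1 ≤ d → 1 ≤ n ε d) {s t : ℝ} (hs : 0 < s) (ht : 0 < t) :
    IsSTWT n s t := by
  obtain ⟨τ, hτ, C, hC, hn⟩ := h
  set l : Filter (ℝ × ℕ) := comap (fun x : ℝ × ℕ => x.1⁻¹ + (x.2 : ℝ)) atTop ⊓
      𝓟 {x : ℝ × ℕ | 0 < x.1 ∧ x.1 < 1 ∧ 1 ≤ x.2} with hl
  set D : ℝ × ℕ → ℝ := fun x => x.1⁻¹ ^ s + (x.2 : ℝ) ^ t with hD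
  have hmem : ∀ᶠ x in l, 0 < x.1 ∧ x.1 < 1 ∧ 1 ≤ x.2 :=
    mem_inf_of_right (mem_principal_self _)
  have hsum : Tendsto (fun x : ℝ × ℕ => x.1⁻¹ + (x.2 : ℝ)) l atTop :=
    tendsto_comap.mono_left inf_le_left
  have hDtop : Tendsto D l atTop := by
    -- The larger of `ε⁻¹` and `d` is at least half their sum, and its power in `D` has exponent at
    -- least `min s t`.
    have hu : 0 < min s t := lt_min hs ht
    refine tendsto_atTop_mono' l ?_
      ((tendsto_rpow_atTop hu).comp (hsum.atTop_div_const (two_pos : (0 : ℝ) < 2)))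
    filter_upwards [hmem] with x ⟨h0, h1, hd⟩
    have hε1 : 1 ≤ x.1⁻¹ := (one_le_inv₀ h0).2 h1.le
    have hd1 : (1 : ℝ) ≤ x.2 := by exact_mod_cast hd
    simp only [Function.comp_apply, hD]
    rcases le_total x.1⁻¹ (x.2 : ℝ) with h | h
    · calc ((x.1⁻¹ + (x.2 : ℝ)) / 2) ^ min s t ≤ (x.2 : ℝ) ^ min s t :=
            Real.rpow_le_rpow (by positivity) (by linarith) hu.le
        _ ≤ (x.2 : ℝ) ^ t := Real.rpow_le_rpow_of_exponent_le hd1 (min_le_right _ _)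
        _ ≤ _ := le_add_of_nonneg_left (by positivity)
    · calc ((x.1⁻¹ + (x.2 : ℝ)) / 2) ^ min s t ≤ x.1⁻¹ ^ min s t :=
            Real.rpow_le_rpow (by positivity) (by linarith) hu.le
        _ ≤ x.1⁻¹ ^ s := Real.rpow_le_rpow_of_exponent_le hε1 (min_le_left _ _)
        _ ≤ _ := le_add_of_nonneg_right (by positivity)
  set c := (1 + (t / 4)⁻¹) * (1 + (s / 4)⁻¹) with hc
  have hlim : Tendsto (fun x => Real.log C / D x + τ * c * (D x) ^ (-(1 / 2) : ℝ)) l (𝓝 0) := by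
    have h1 : Tendsto (fun x => Real.log C / D x) l (𝓝 0) :=
      tendsto_const_nhds.div_atTop hDtop
    have h2 := ((tendsto_rpow_neg_atTop (y := 1 / 2) (by norm_num)).comp hDtop).const_mul (τ * c)
    simpa using h1.add h2
  have hlim' := (continuous_coe_real_ereal.tendsto 0).comp hlim
  refine tendsto_of_tendsto_of_tendsto_of_le_of_le' tendsto_const_nhds hlim' ?_ ?_
  · filter_upwards [hmem] with x ⟨h0, h1, hd⟩
    refine EReal.div_nonneg ?_ (EReal.coe_nonneg.2 (by positivity))
    rw [← ENNReal.log_one]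
    refine ENNReal.log_monotone ?_
    exact_mod_cast ENat.toENNReal_le.2 (hone _ _ h0 h1 hd)
  · filter_upwards [hmem] with x ⟨h0, h1, hd⟩
    have hε1 : 1 ≤ x.1⁻¹ := (one_le_inv₀ h0).2 h1.le
    have hd1 : (1 : ℝ) ≤ x.2 := by exact_mod_cast hd
    have hDpos : 0 < D x := by simp only [hD]; positivity
    have h2 : ENNReal.log (n x.1 x.2 : ℝ≥0∞) ≤
        ((Real.log C + τ * (1 + Real.log x.2) * (1 + Real.log x.1⁻¹) : ℝ) : EReal) := by
      refine (ENNReal.log_monotone (hn x.2 hd x.1 h0 h1)).trans_eq ?_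
      rw [ENNReal.log_ofReal_of_pos (by positivity), Real.log_mul hC.ne' (Real.exp_pos _).ne',
        Real.log_exp]
    refine (EReal.div_le_div_right_of_nonneg (EReal.coe_nonneg.2 hDpos.le) h2).trans ?_
    rw [← EReal.coe_div]
    refine EReal.coe_le_coe_iff.2 ?_
    have h3 : (x.2 : ℝ) ^ (t / 4) ≤ D x ^ (1 / 4 : ℝ) := by
      rw [div_eq_mul_one_div, Real.rpow_mul (by positivity)]
      exact Real.rpow_le_rpow (by positivity) (le_add_of_nonneg_left (by positivity))
        (by norm_num)
    have h4 : x.1⁻¹ ^ (s / 4) ≤ D x ^ (1 / 4 : ℝ) := by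
      rw [div_eq_mul_one_div, Real.rpow_mul (by positivity)]
      exact Real.rpow_le_rpow (by positivity) (le_add_of_nonneg_right (by positivity))
        (by norm_num)
    have h5 := one_add_log_le_rpow (by positivity : 0 < t / 4) hd1
    have h6 := one_add_log_le_rpow (by positivity : 0 < s / 4) hε1
    have h7 : (1 + Real.log x.2) * (1 + Real.log x.1⁻¹) ≤ c * D x ^ (1 / 2 : ℝ) := by
      have h8 : D x ^ (1 / 2 : ℝ) = D x ^ (1 / 4 : ℝ) * D x ^ (1 / 4 : ℝ) := by
        rw [← Real.rpow_add hDpos]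
        norm_num
      rw [h8, hc]
      calc (1 + Real.log x.2) * (1 + Real.log x.1⁻¹)
          ≤ ((1 + (t / 4)⁻¹) * D x ^ (1 / 4 : ℝ)) * ((1 + (s / 4)⁻¹) * D x ^ (1 / 4 : ℝ)) := by
            refine mul_le_mul (h5.trans (by gcongr)) (h6.trans (by gcongr)) ?_ (by positivity)
            linarith [Real.log_nonneg hε1]
        _ = _ := by ring
    have h9 : D x ^ (-(1 / 2) : ℝ) = D x ^ (1 / 2 : ℝ) / D x := by
      rw [eq_div_iff hDpos.ne', ← Real.rpow_add_one hDpos.ne']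
      norm_num
    change (Real.log C + τ * (1 + Real.log x.2) * (1 + Real.log x.1⁻¹)) / D x ≤
      Real.log C / D x + τ * c * D x ^ (-(1 / 2) : ℝ)
    rw [h9, ← mul_div_assoc, ← add_div]
    refine div_le_div_of_nonneg_right ?_ hDpos.le
    rw [mul_assoc τ, mul_assoc τ]
    gcongr


theorem mainTheorem5 (γ : ℕ → ℝ)
    (hpos : ∀ k : ℕ, 1 ≤ k → 0 < γ k ^ 2)
    (hanti : ∀ k : ℕ, 1 ≤ k → γ (k + 1) ^ 2 ≤ γ k ^ 2) :
    -- strong polynomial tractability and its exponent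
    (liminf (fun k : ℕ => ((Real.log (gaussianOmega (γ k))⁻¹ / Real.log k : ℝ) : EReal)) atTop
        = shapeDecay γ ∧
      (IsSPT (gaussianInfo γ) ↔ 0 < shapeDecay γ) ∧
      (IsSPT (gaussianInfo γ) → sptExponent (gaussianInfo γ) = 2 / shapeDecay γ)) ∧
    -- strong polynomial and polynomial tractability are equivalent
    (IsSPT (gaussianInfo γ) ↔ IsPT (gaussianInfo γ)) ∧
    -- quasi-polynomial tractability and its exponent
    (IsQPT (gaussianInfo γ) ∧
      ∃ B : EReal, 0 < B ∧
        Tendsto (fun k : ℕ => ((Real.log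
          ((1 + 2 * γ k ^ 2 + √(1 + 4 * γ k ^ 2)) / (2 * γ k ^ 2)) : ℝ) : EReal)) atTop (𝓝 B) ∧
        qptExponent (gaussianInfo γ) = 2 / B) ∧
    -- the weaker tractability notions
    ((∀ s t : ℝ, 0 < s → 0 < t → IsSTWT (gaussianInfo γ) s t) ∧
      IsUWT (gaussianInfo γ) ∧ IsWT (gaussianInfo γ)) := by
  have hSPT := isSPT_gaussianInfo_iff hpos hanti
  have hQPT := isQPT_gaussianInfo hpos hanti
  have hST : ∀ s t : ℝ, 0 < s → 0 < t → IsSTWT (gaussianInfo γ) s t := fun s t hs ht =>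
    hQPT.isSTWT (fun _ _ h0 h1 _ => one_le_gaussianInfo hpos hanti h0 h1) hs ht
  refine ⟨⟨liminf_log_gaussianOmega_inv hpos hanti, hSPT, fun h => ?_⟩,
    ⟨IsSPT.isPT, fun h => hSPT.2 (shapeDecay_pos_of_isPT hpos hanti h)⟩, ⟨hQPT, ?_⟩,
    hST, hST, hST 1 1 one_pos one_pos⟩
  · exact iInf_eq_two_div (hSPT.1 h) (fun p => two_div_le_shapeDecay_of_sptBound hpos hanti)
      fun p => sptBound_of_two_div_lt_shapeDecay hpos hanti
  · obtain ⟨B, hB0, hB, hle⟩ := exists_tendsto_log_gaussianOmega_inv hpos hanti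
    refine ⟨B, hB0, ?_, qptExponent_gaussianInfo hpos hanti hB0 hB hle⟩
    simpa only [gaussianOmega_inv] using hB
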